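/- **Proposition (state feedback).** Write $a^\times$ for the skew-symmetric matrix with $a^\times b=a\times b$, $\|\cdot\|$ for the Euclidean norm and the induced matrix norm, $q=(q_v,q_4)$ for a unit quaternion, $\bar q=(0,0,0,1)$, and $$C(q)=(q_4^2-q_v^{T}q_v)I+2q_vq_v^{T}-2q_4q_v^\times ,\qquad W(q)=\tfrac12\begin{bmatrix}q_4I+q_v^\times\\-q_v^{T}\end{bmatrix}.$$ Consider a rigid spacecraft with symmetric positive definite inertia matrix $J\in\mathbb R^{3\times3}$ on a circular orbit of radius $R>0$, orbital rate $n>0$, initial phase $\phi_0$, inclination $incl$ and right ascension of the ascending node $\Omega$, in the dipole geomagnetic field which in inertial coordinates is $$B^i(t)=\frac{\mu_m}{R^3}\bigl[3(\hat m^{T}\hat r(t))\hat r(t)-\hat m\bigr],\qquad \hat m=(0,0,-1)^{T},\qquad \hat r(t)=R_z(\Omega)R_x(incl)\begin{bmatrix}\cos(nt+\phi_0)\\ \sin(nt+\phi_0)\\0\end{bmatrix},$$ where $\mu_m>0$ and $R_x(\theta),R_z(\theta)$ are the rotations by the angle $\theta$ about the first and the third axis. With three magnetic coils its attitude motion is $$\dot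 q=W(q)\,\omega,\qquad J\dot\omega=-\omega^\times J\omega-B^b(q,t)^\times m_{coils},\qquad B^b(q,t)=C(q)B^i(t).\tag{1}$$ For $k_1,k_2>0$, $\epsilon>0$ and a sampling period $T>0$, apply the piecewise-constant state feedback $$m_{coils}(t)=\bigl(B^b(q(kT),kT)^\times\bigr)^{T}\bigl(\epsilon^2k_1q_v(kT)+\epsilon k_2\,\omega(kT)\bigr),\qquad kT\le t<(k+1)T,\quad k=0,1,2,\dots\tag{2}$$ For $k\in\mathbb Z$ and $T>0$ let $$G_2(k,T)=\int_{kT}^{(k+1)T}B^i(\tau)^\times d\tau,\qquad H_2(k,T)=\int_0^1\frac{\partial G_2}{\partial T}(k,sT)\,ds,\qquad L(k,T)=H_2(k,T)\bigl(B^i(kT)^\times\bigr)^{T},$$ $$L_{av}(T)=\lim_{N\to\infty}\frac1N\sum_{k=s+1}^{s+N}L(k,T),\qquad L_{av}^0=\lim_{T\to0^+}L_{av}(T),\qquad A_s(T)=\begin{bmatrix}0&\frac12I\\-k_1J^{-1}L_{av}(T)&-k_2J^{-1}L_{av}(T)\end{bmatrix}.$$ The limit defining $L_{av}(T)$ exists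 for all $T>0$ and $s\in\mathbb Z$ and does not depend on $s$, and the limit defining $L_{av}^0$ exists. Assume that $L_{av}^0$ is symmetric positive definite. Then there is $T^*>0$ such that, for every $0<T<T^*$, the Lyapunov equation $$P_sA_s(T)+A_s(T)^{T}P_s=-I$$ has a symmetric positive definite solution $P_s$, and for this $P_s$ and $$\epsilon_0=\frac1{2T\,\|A_s(T)^{T}P_sA_s(T)\|}$$ there is $0<\epsilon_1\le\epsilon_0$ such that for all $0<\epsilon\le\epsilon_1$ the equilibrium $(q,\omega)=(\bar q,0)$ of the closed loop (1), (2) is locally exponentially stable. That is, there are $\delta,K,\lambda>0$ such that, for every sampling instant $t_0=k_0T$ ($k_0=0,1,2,\dots$), every initial state $(q,\omega)(t_0)$ with $\|q(t_0)\|=1$ at distance less than $\delta$ from $(\bar q,0)$ has a solution on $[t_0,\infty)$, and every solution from such an initial state satisfies $$\|(q(t)-\bar q,\ \omega(t))\|\le K e^{-\lambda(t-t_0)}\,\|(q(t_0)-\bar q,\ \omega(t_0))\|\qquad\text{for all }t\ge t_0 .$$ -/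

import Mathlib

open Set Filter Topology
open scoped Matrix

noncomputable section

namespace MagSat

/-- The skew-symmetric matrix `a^×`, for which `a^× b` is the cross product of `a` and `b`. -/
def skew (a : Fin 3 → ℝ) : Matrix (Fin 3) (Fin 3) ℝ :=
  !![0, -a 2, a 1; a 2, 0, -a 0; -a 1, a 0, 0]

/-- Vector part `q_v` of a quaternion `q = (q_v, q_4)`; the scalar part `q_4` is `q 3`. -/
def qv (q : Fin 4 → ℝ) : Fin 3 → ℝ := ![q 0, q 1, q 2]

/-- The target attitude `(0, 0, 0, 1)`. -/
def qbar : Fin 4 → ℝ := ![0, 0, 0, 1]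

/-- Attitude matrix `C(q) = (q_4² - q_vᵀ q_v) I + 2 q_v q_vᵀ - 2 q_4 q_v^×`. -/
def attitude (q : Fin 4 → ℝ) : Matrix (Fin 3) (Fin 3) ℝ :=
  ((q 3) ^ 2 - qv q ⬝ᵥ qv q) • (1 : Matrix (Fin 3) (Fin 3) ℝ)
    + (2 : ℝ) • Matrix.vecMulVec (qv q) (qv q) - (2 * q 3) • skew (qv q)

/-- The `4 × 3` matrix `W(q)`, one half of `q_4 I + q_v^×` stacked on top of `-q_vᵀ`. -/
def W (q : Fin 4 → ℝ) : Matrix (Fin 4) (Fin 3) ℝ :=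
  (1 / 2 : ℝ) • !![q 3, -q 2, q 1; q 2, q 3, -q 0; -q 1, q 0, q 3; -q 0, -q 1, -q 2]

/-- Data of a circular orbit and of the geomagnetic dipole: dipole strength `μ`, orbit radius `R`,
orbital rate `n`, initial phase `φ₀`, inclination `incl`, right ascension of the ascending
node `Ω`. -/
structure Orbit where
  μ : ℝ
  R : ℝ
  n : ℝ
  φ₀ : ℝ
  incl : ℝ
  Ω : ℝ

/-- Rotation matrix from the coordinates of the orbital plane (first axis through the ascending
node, third axis normal to the orbit) to inertial coordinates: a rotation by `incl` about the
first axis followed by a rotation by `Ω` about the third one. -/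
def Orbit.rot (o : Orbit) : Matrix (Fin 3) (Fin 3) ℝ :=
  !![Real.cos o.Ω, -Real.sin o.Ω, 0; Real.sin o.Ω, Real.cos o.Ω, 0; 0, 0, 1] *
    !![1, 0, 0; 0, Real.cos o.incl, -Real.sin o.incl; 0, Real.sin o.incl, Real.cos o.incl]

/-- Position `r(t)` of the spacecraft in inertial coordinates. -/
def Orbit.pos (o : Orbit) (t : ℝ) : Fin 3 → ℝ :=
  o.rot *ᵥ ![o.R * Real.cos (o.n * t + o.φ₀), o.R * Real.sin (o.n * t + o.φ₀), 0]

/-- Direction cosines of `r(t)`. The orbit is circular, so the length of `r(t)` is the radius. -/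
def Orbit.dir (o : Orbit) (t : ℝ) : Fin 3 → ℝ := (o.R)⁻¹ • o.pos t

/-- Direction cosines of the Earth's magnetic dipole moment (colatitude 180 degrees). -/
def dipoleDir : Fin 3 → ℝ := ![0, 0, -1]

/-- Dipole model of the geomagnetic field at the spacecraft, in inertial coordinates. -/
def Orbit.Bi (o : Orbit) (t : ℝ) : Fin 3 → ℝ :=
  (o.μ / o.R ^ 3) • ((3 * (dipoleDir ⬝ᵥ o.dir t)) • o.dir t - dipoleDir)

/-- Geomagnetic field at the spacecraft in body coordinates, at attitude `q` and time `t`. -/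
def Orbit.Bb (o : Orbit) (q : Fin 4 → ℝ) (t : ℝ) : Fin 3 → ℝ := attitude q *ᵥ o.Bi t

/-- The magnetic dipole moment that the state feedback computes from the state `(q, ω)` measured
at time `t`; it is then held until the next sampling instant. -/
def Orbit.feedback (o : Orbit) (k₁ k₂ ε : ℝ) (q : Fin 4 → ℝ) (ω : Fin 3 → ℝ) (t : ℝ) :
    Fin 3 → ℝ :=
  (skew (o.Bb q t))ᵀ *ᵥ ((ε ^ 2 * k₁) • qv q + (ε * k₂) • ω)

/-- `(q, ω)` is a solution, from the sampling instant `k₀ T` on, of the closed loop of the spacecraft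
with inertia matrix `J` and the piecewise-constant state feedback: `q` is a unit quaternion and on
every sampling interval `[kT, (k+1)T]`, with the dipole moment frozen at its value computed at `kT`,
`q̇ = W(q) ω` and `J ω̇ = -ω^× J ω - B^b(q,t)^× m`. At the two ends of an interval the derivatives
are one-sided. -/
structure IsSolution (o : Orbit) (J : Matrix (Fin 3) (Fin 3) ℝ) (k₁ k₂ ε T : ℝ) (k₀ : ℕ)
    (q : ℝ → Fin 4 → ℝ) (ω : ℝ → Fin 3 → ℝ) : Prop where
  unit : ∀ t : ℝ, k₀ * T ≤ t → ‖WithLp.toLp 2 (q t)‖ = 1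
  kinematics : ∀ k : ℕ, k₀ ≤ k → ∀ t ∈ Icc (k * T) ((k + 1) * T),
    HasDerivWithinAt q (W (q t) *ᵥ ω t) (Icc (k * T) ((k + 1) * T)) t
  dynamics : ∀ k : ℕ, k₀ ≤ k → ∀ t ∈ Icc (k * T) ((k + 1) * T),
    HasDerivWithinAt (fun τ => J *ᵥ ω τ)
      (-(skew (ω t) *ᵥ (J *ᵥ ω t))
        - skew (o.Bb (q t) t) *ᵥ o.feedback k₁ k₂ ε (q (k * T)) (ω (k * T)) (k * T))
      (Icc (k * T) ((k + 1) * T)) t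

/-- Euclidean distance of the state `(q, ω)` from the equilibrium `(qbar, 0)`. -/
def stateErr (q : Fin 4 → ℝ) (ω : Fin 3 → ℝ) : ℝ :=
  ‖WithLp.toLp 2 (Sum.elim (q - qbar) ω)‖

/-- Local exponential stability of `(qbar, 0)` for the closed loop on unit quaternions times `ℝ³`:
all initial states close to the equilibrium, given at any sampling instant, have a solution for all
later times, and all these solutions decay exponentially to the equilibrium, with constants that
depend neither on the initial state nor on the initial instant. -/
def LocallyExpStable (o : Orbit) (J : Matrix (Fin 3) (Fin 3) ℝ) (k₁ k₂ ε T : ℝ) : Prop :=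
  ∃ δ > 0, ∃ K > 0, ∃ lam > 0, ∀ k₀ : ℕ,
    (∀ (q₀ : Fin 4 → ℝ) (ω₀ : Fin 3 → ℝ), ‖WithLp.toLp 2 q₀‖ = 1 → stateErr q₀ ω₀ < δ →
      ∃ q ω, IsSolution o J k₁ k₂ ε T k₀ q ω ∧ q (k₀ * T) = q₀ ∧ ω (k₀ * T) = ω₀) ∧
    (∀ q ω, IsSolution o J k₁ k₂ ε T k₀ q ω → stateErr (q (k₀ * T)) (ω (k₀ * T)) < δ →
      ∀ t : ℝ, k₀ * T ≤ t →
        stateErr (q t) (ω t)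
          ≤ K * Real.exp (-lam * (t - k₀ * T)) * stateErr (q (k₀ * T)) (ω (k₀ * T)))

/-- `G₂(k,T) = ∫_{kT}^{(k+1)T} B^i(τ)^× dτ`, entry by entry. -/
def Orbit.G₂ (o : Orbit) (k : ℤ) (T : ℝ) : Matrix (Fin 3) (Fin 3) ℝ :=
  Matrix.of fun i j => ∫ τ in (k * T)..((k + 1) * T), skew (o.Bi τ) i j

/-- `H₂(k,T) = ∫_0^1 (∂G₂/∂T)(k,sT) ds`, entry by entry, so that `G₂(k,T) = H₂(k,T) T`. -/
def Orbit.H₂ (o : Orbit) (k : ℤ) (T : ℝ) : Matrix (Fin 3) (Fin 3) ℝ :=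
  Matrix.of fun i j => ∫ s in (0 : ℝ)..1, deriv (fun u => o.G₂ k u i j) (s * T)

/-- `L(k,T) = H₂(k,T) (B^i(kT)^×)ᵀ`. -/
def Orbit.L (o : Orbit) (k : ℤ) (T : ℝ) : Matrix (Fin 3) (Fin 3) ℝ :=
  o.H₂ k T * (skew (o.Bi (k * T)))ᵀ

/-- The mean of `L(k,T)` over `k = s+1, …, s+N`. -/
def Orbit.meanL (o : Orbit) (T : ℝ) (s : ℤ) (N : ℕ) : Matrix (Fin 3) (Fin 3) ℝ :=
  (1 / (N : ℝ)) • ∑ k ∈ Finset.Icc (s + 1) (s + N), o.L k T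

/-- `L_av(T)`, the limit of the means of `L(k,T)` as `N → ∞`. -/
def Orbit.Lav (o : Orbit) (T : ℝ) : Matrix (Fin 3) (Fin 3) ℝ :=
  limUnder atTop (o.meanL T 0)

/-- The limit of `L_av(T)` as the sampling period `T > 0` tends to `0`. -/
def Orbit.Lav₀ (o : Orbit) : Matrix (Fin 3) (Fin 3) ℝ :=
  limUnder (𝓝[>] (0 : ℝ)) o.Lav

/-- The matrix `A_s(T)` of the averaged system, with rows `(0, I/2)` and
`(-k₁ J⁻¹ L_av(T), -k₂ J⁻¹ L_av(T))`. -/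
def Orbit.As (o : Orbit) (J : Matrix (Fin 3) (Fin 3) ℝ) (k₁ k₂ T : ℝ) :
    Matrix (Fin 3 ⊕ Fin 3) (Fin 3 ⊕ Fin 3) ℝ :=
  Matrix.fromBlocks 0 ((1 / 2 : ℝ) • 1) (-(k₁ • (J⁻¹ * o.Lav T))) (-(k₂ • (J⁻¹ * o.Lav T)))

/-- `P` is symmetric positive definite and solves the Lyapunov equation `P A + Aᵀ P = -I`
(this forces `A` to be Hurwitz, and `P` is then unique). -/
def IsLyapunovSolution (A P : Matrix (Fin 3 ⊕ Fin 3) (Fin 3 ⊕ Fin 3) ℝ) : Prop :=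
  P.PosDef ∧ P * A + Aᵀ * P = -1

/-- `ε₀ = 1 / (2 T ‖Aᵀ P A‖)`, with the operator norm induced by the Euclidean norm. -/
def eps₀ (T : ℝ) (A P : Matrix (Fin 3 ⊕ Fin 3) (Fin 3 ⊕ Fin 3) ℝ) : ℝ :=
  1 / (2 * T * ‖Matrix.toEuclideanCLM (𝕜 := ℝ) (n := Fin 3 ⊕ Fin 3) (Aᵀ * P * A)‖)

end MagSat

end

noncomputable section

namespace MagSat

/-! Substituting `ω = ε w` turns the closed loop into `ż = ε f`, so one sampling period moves the
state by `O(ε)`. Let `x = (q_v, w)`. Integrating the linearization at the equilibrium over `[kT,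
(k+1)T]`, with the state frozen at its sampled value, gives `x(k+1) = x(k) + ε T A(k) x(k) + O(ε (ε
‖x‖ + ‖x‖²))`, where `A(k)` is `A_s` with `L(k,T)` in place of `L_av(T)`
(`IsArc.norm_reduced_step_le`). The missing coordinate `q_4 - 1` is controlled by `q_v` because `q`
is a unit quaternion (`norm_sub_zbar_le_three_mul`).

The dipole field is a trigonometric polynomial of degree one in `2(nt + φ₀)`. The entries of
`L(k,T)` are therefore trigonometric polynomials in `k`, and the sums of `L - L_av` over integer
intervals are bounded uniformly in both the start and the length (`Orbit.hasMean_L`). Hence `A(k) =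
A_s + S(k+1) - S(k)` with `S` bounded. In the coordinate `y = x - ε T S x` the oscillating part
cancels to first order, and a quadratic Lyapunov function of `A_s` contracts for small `ε`
(`exists_discrete_averaging`). Uniformity in the start makes all constants independent of the
initial sampling instant.

For symmetric positive definite `L_av⁰` an explicit quadratic form decreases strictly along the
averaged system. Strictness survives the replacement of `L_av⁰` by `L_av(T)` with `T` small, and a
strictly decreasing positive form is enough to solve the Lyapunov equation with a positive definite
solution (`exists_lyapunov_solution`). The number `ε₀` is only an upper cap on `ε₁`; what matters is
that it is positive (`eps₀_pos`). -/

/-! ### Means of trigonometric sequences over integer intervals. -/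

/-- The sums of `f` over integer intervals of length `N` are `N * c` up to a uniform error. -/
def HasMean (f : ℤ → ℝ) (c : ℝ) : Prop :=
  ∃ C, ∀ (s : ℤ) (N : ℕ), |∑ i ∈ Finset.range N, f (s + 1 + i) - N * c| ≤ C

theorem HasMean.const (c : ℝ) : HasMean (fun _ => c) c :=
  ⟨0, fun s N => by simp⟩

theorem HasMean.add {f g : ℤ → ℝ} {c d : ℝ} (hf : HasMean f c) (hg : HasMean g d) :
    HasMean (fun k => f k + g k) (c + d) := by
  obtain ⟨C, hC⟩ := hf
  obtain ⟨D, hD⟩ := hg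
  refine ⟨C + D, fun s N => ?_⟩
  rw [Finset.sum_add_distrib]
  have : ∑ i ∈ Finset.range N, f (s + 1 + i) + ∑ i ∈ Finset.range N, g (s + 1 + i) - N * (c + d)
      = (∑ i ∈ Finset.range N, f (s + 1 + i) - N * c)
        + (∑ i ∈ Finset.range N, g (s + 1 + i) - N * d) := by ring
  rw [this]
  exact (abs_add_le _ _).trans (add_le_add (hC s N) (hD s N))

theorem HasMean.const_mul {f : ℤ → ℝ} {c : ℝ} (hf : HasMean f c) (a : ℝ) :
    HasMean (fun k => a * f k) (a * c) := by
  obtain ⟨C, hC⟩ := hf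
  refine ⟨|a| * C, fun s N => ?_⟩
  rw [← Finset.mul_sum,
    show a * ∑ i ∈ Finset.range N, f (s + 1 + i) - N * (a * c)
      = a * (∑ i ∈ Finset.range N, f (s + 1 + i) - N * c) by ring, abs_mul]
  exact mul_le_mul_of_nonneg_left (hC s N) (abs_nonneg a)

theorem HasMean.sum {ι : Type*} (t : Finset ι) {f : ι → ℤ → ℝ} {c : ι → ℝ}
    (h : ∀ i ∈ t, HasMean (f i) (c i)) : HasMean (fun k => ∑ i ∈ t, f i k) (∑ i ∈ t, c i) := by
  classical
  induction t using Finset.induction_on with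
  | empty => simpa using HasMean.const 0
  | insert a t ha ih =>
    simp only [Finset.sum_insert ha]
    exact (h a (by simp)).add (ih fun i hi => h i (by simp [hi]))

theorem HasMean.tendsto {f : ℤ → ℝ} {c : ℝ} (hf : HasMean f c) (s : ℤ) :
    Tendsto (fun N : ℕ => (1 / (N : ℝ)) * ∑ i ∈ Finset.range N, f (s + 1 + i)) atTop (𝓝 c) := by
  obtain ⟨C, hC⟩ := hf
  rw [tendsto_iff_norm_sub_tendsto_zero]
  have h0 : Tendsto (fun N : ℕ => C / (N : ℝ)) atTop (𝓝 0) :=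
    tendsto_const_div_atTop_nhds_zero_nat C
  refine squeeze_zero' (Eventually.of_forall fun _ => norm_nonneg _) ?_ h0
  filter_upwards [eventually_gt_atTop 0] with N hN
  have hN' : (0 : ℝ) < N := by exact_mod_cast hN
  rw [show (1 / (N : ℝ)) * ∑ i ∈ Finset.range N, f (s + 1 + i) - c
      = (∑ i ∈ Finset.range N, f (s + 1 + i) - N * c) / N by field_simp, norm_div,
    Real.norm_eq_abs, Real.norm_eq_abs, abs_of_pos hN']
  exact div_le_div_of_nonneg_right (hC s N) hN'.le

theorem HasMean.unique {f : ℤ → ℝ} {c d : ℝ} (hc : HasMean f c) (hd : HasMean f d) : c = d :=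
  tendsto_nhds_unique (hc.tendsto 0) (hd.tendsto 0)

/-- Multiplication by `2 sin (α/2)` makes the sum of cosines telescope, which bounds it uniformly in
`s` and `N`. -/
theorem hasMean_cos_of_ne (α β : ℝ) (h : Real.sin (α / 2) ≠ 0) :
    HasMean (fun k => Real.cos (α * k + β)) 0 := by
  refine ⟨1 / |Real.sin (α / 2)|, fun s N => ?_⟩
  have key : ∀ N : ℕ, 2 * Real.sin (α / 2) *
      ∑ i ∈ Finset.range N, Real.cos (α * ((s + 1 + i : ℤ) : ℝ) + β)
      = Real.sin (α * (s + 1 + N) + β - α / 2) - Real.sin (α * (s + 1) + β - α / 2) := by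
    intro N
    induction N with
    | zero => simp
    | succ N ih =>
      rw [Finset.sum_range_succ, mul_add, ih]
      push_cast
      rw [show α * ((s : ℝ) + 1 + (N + 1)) + β - α / 2 = (α * (s + 1 + N) + β) + α / 2 by ring,
        Real.sin_add (α * (s + 1 + N) + β), Real.sin_sub (α * (s + 1 + N) + β)]
      ring
  have h2 : |2 * Real.sin (α / 2) *
      ∑ i ∈ Finset.range N, Real.cos (α * ((s + 1 + i : ℤ) : ℝ) + β)| ≤ 2 := by
    rw [key]
    refine (abs_sub _ _).trans ?_
    linarith [Real.abs_sin_le_one (α * (s + 1 + N) + β - α / 2),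
      Real.abs_sin_le_one (α * (s + 1) + β - α / 2)]
  rw [abs_mul, abs_mul, abs_two] at h2
  rw [mul_zero, sub_zero, le_div_iff₀ (abs_pos.2 h)]
  linarith

theorem exists_hasMean_cos (α β : ℝ) : ∃ c, HasMean (fun k => Real.cos (α * k + β)) c := by
  by_cases h : Real.sin (α / 2) = 0
  -- Aliasing: `α` is a multiple of `2π`, so the sampled cosine is constant.
  · obtain ⟨m, hm⟩ := Real.sin_eq_zero_iff.1 h
    refine ⟨Real.cos β, ?_⟩
    convert HasMean.const (Real.cos β) using 2 with k
    rw [show α * k + β = β + ((m * k : ℤ) : ℝ) * (2 * Real.pi) by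
      push_cast; linear_combination (-2 * (k : ℝ)) * hm]
    exact Real.cos_add_int_mul_two_pi _ _
  · exact ⟨0, hasMean_cos_of_ne α β h⟩

/-- Products of trigonometric polynomials of degree one: the mean exists, and it is given by the
orthogonality relations if there is no aliasing. -/
theorem hasMean_trig_mul (a u v a' b' c' γ β : ℝ) :
    ∃ m, HasMean (fun k : ℤ => (a + u * Real.cos (γ * k + β) + v * Real.sin (γ * k + β)) *
      (a' + b' * Real.cos (γ * k + β) + c' * Real.sin (γ * k + β))) m ∧
      (0 < γ → γ < Real.pi → m = a * a' + (u * b' + v * c') / 2) := by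
  -- Product-to-sum formulas. Sines are written as cosines shifted by `π/2`, so the cosine lemmas
  -- suffice; `0 < γ < π` ensures that neither `γ` nor `2γ` is aliased.
  have e : (fun k : ℤ => (a + u * Real.cos (γ * k + β) + v * Real.sin (γ * k + β)) *
      (a' + b' * Real.cos (γ * k + β) + c' * Real.sin (γ * k + β))) = fun k : ℤ =>
      (((a * a' + (u * b' + v * c') / 2) + (a * b' + u * a') * Real.cos (γ * k + β))
      + (a * c' + v * a') * Real.cos (γ * k + (β - Real.pi / 2)))
      + ((u * b' - v * c') / 2 * Real.cos (2 * γ * k + 2 * β)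
      + (u * c' + v * b') / 2 * Real.cos (2 * γ * k + (2 * β - Real.pi / 2))) := by
    funext k
    rw [← add_sub_assoc, Real.cos_sub_pi_div_two, ← add_sub_assoc, Real.cos_sub_pi_div_two,
      show 2 * γ * (k : ℝ) + 2 * β = 2 * (γ * k + β) by ring, Real.cos_two_mul, Real.sin_two_mul]
    linear_combination (v * c') * Real.sin_sq_add_cos_sq (γ * k + β)
  rw [e]
  by_cases h : 0 < γ ∧ γ < Real.pi
  · have h1 : Real.sin (γ / 2) ≠ 0 :=
      (Real.sin_pos_of_pos_of_lt_pi (by linarith) (by linarith)).ne'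
    have h2 : Real.sin (2 * γ / 2) ≠ 0 :=
      (Real.sin_pos_of_pos_of_lt_pi (by linarith) (by linarith)).ne'
    refine ⟨_, (((HasMean.const _).add ((hasMean_cos_of_ne _ _ h1).const_mul _)).add
      ((hasMean_cos_of_ne _ _ h1).const_mul _)).add (((hasMean_cos_of_ne _ _ h2).const_mul _).add
      ((hasMean_cos_of_ne _ _ h2).const_mul _)), fun _ _ => by ring⟩
  · obtain ⟨c1, h1⟩ := exists_hasMean_cos γ β
    obtain ⟨c2, h2⟩ := exists_hasMean_cos γ (β - Real.pi / 2)
    obtain ⟨c3, h3⟩ := exists_hasMean_cos (2 * γ) (2 * β)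
    obtain ⟨c4, h4⟩ := exists_hasMean_cos (2 * γ) (2 * β - Real.pi / 2)
    exact ⟨_, (((HasMean.const _).add (h1.const_mul _)).add
      (h2.const_mul _)).add ((h3.const_mul _).add (h4.const_mul _)), fun h5 h6 => absurd ⟨h5, h6⟩ h⟩

theorem sum_Icc_eq_sum_range {M : Type*} [AddCommMonoid M] (f : ℤ → M) (s : ℤ) (N : ℕ) :
    ∑ k ∈ Finset.Icc (s + 1) (s + N), f k = ∑ i ∈ Finset.range N, f (s + 1 + i) := by
  induction N with
  | zero => simp
  | succ N ih =>
    rw [Finset.sum_range_succ, ← ih]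
    have : Finset.Icc (s + 1) (s + (N + 1 : ℕ)) = insert (s + 1 + N) (Finset.Icc (s + 1) (s + N)) := by
      ext k; simp only [Finset.mem_Icc, Finset.mem_insert]; push_cast; omega
    rw [this, Finset.sum_insert (by simp), add_comm]

/-! ### Harmonics of the dipole field and the averaged matrix `L_av(T)`. -/

theorem skew_add (a b : Fin 3 → ℝ) : skew (a + b) = skew a + skew b := by
  ext i j
  fin_cases i <;> fin_cases j <;> simp [skew] <;> ring

theorem skew_smul (r : ℝ) (a : Fin 3 → ℝ) : skew (r • a) = r • skew a := by
  ext i j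
  fin_cases i <;> fin_cases j <;> simp [skew]

/-- The field is quadratic in the direction of the satellite, which has frequency `n`; the
double-angle formulas leave only a constant and the frequency `2n`. -/
theorem Orbit.exists_Bi_eq (o : Orbit) (hR : o.R ≠ 0) : ∃ a b c : Fin 3 → ℝ, ∀ t,
    o.Bi t = a + Real.cos (2 * (o.n * t + o.φ₀)) • b + Real.sin (2 * (o.n * t + o.φ₀)) • c := by
  set r₁ : Fin 3 → ℝ := fun i => o.rot i 0
  set r₂ : Fin 3 → ℝ := fun i => o.rot i 1
  have hdir : ∀ t, o.dir t = Real.cos (o.n * t + o.φ₀) • r₁ + Real.sin (o.n * t + o.φ₀) • r₂ := by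
    intro t
    ext i
    simp only [Orbit.dir, Orbit.pos, Matrix.mulVec, dotProduct, Fin.sum_univ_three, r₁, r₂,
      Pi.smul_apply, Pi.add_apply, smul_eq_mul, Matrix.cons_val_zero, Matrix.cons_val_one,
      Matrix.cons_val]
    field_simp
    ring
  set α := dipoleDir ⬝ᵥ r₁
  set β := dipoleDir ⬝ᵥ r₂
  refine ⟨(o.μ / o.R ^ 3) • ((3 / 2 : ℝ) • (α • r₁ + β • r₂) - dipoleDir),
    (o.μ / o.R ^ 3) • ((3 / 2 : ℝ) • (α • r₁ - β • r₂)),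
    (o.μ / o.R ^ 3) • ((3 / 2 : ℝ) • (α • r₂ + β • r₁)), fun t => ?_⟩
  rw [Orbit.Bi, hdir, dotProduct_add, dotProduct_smul, dotProduct_smul, Real.cos_two_mul,
    Real.sin_two_mul]
  ext i
  simp only [Pi.smul_apply, Pi.add_apply, Pi.sub_apply, smul_eq_mul]
  change o.μ / o.R ^ 3 * (3 * (Real.cos (o.n * t + o.φ₀) * α + Real.sin (o.n * t + o.φ₀) * β) *
    (Real.cos (o.n * t + o.φ₀) * r₁ i + Real.sin (o.n * t + o.φ₀) * r₂ i) - dipoleDir i) = _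
  linear_combination (o.μ / o.R ^ 3 * 3 * β * r₂ i) * Real.sin_sq_add_cos_sq (o.n * t + o.φ₀)

theorem Orbit.exists_skew_Bi_eq (o : Orbit) (hR : o.R ≠ 0) :
    ∃ a b c : Matrix (Fin 3) (Fin 3) ℝ, ∀ t i j, skew (o.Bi t) i j =
      a i j + b i j * Real.cos (2 * (o.n * t + o.φ₀)) + c i j * Real.sin (2 * (o.n * t + o.φ₀)) := by
  obtain ⟨a, b, c, h⟩ := o.exists_Bi_eq hR
  refine ⟨skew a, skew b, skew c, fun t i j => ?_⟩
  rw [h, skew_add, skew_add, skew_smul, skew_smul]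
  simp only [Matrix.add_apply, Matrix.smul_apply, smul_eq_mul]
  ring

theorem integral_deriv_comp_mul {g : ℝ → ℝ} (hg : ContDiff ℝ 1 g) {T : ℝ} (hT : T ≠ 0) :
    ∫ s in (0 : ℝ)..1, deriv g (s * T) = (g T - g 0) / T := by
  rw [intervalIntegral.integral_comp_mul_right _ hT, zero_mul, one_mul,
    intervalIntegral.integral_deriv_eq_sub (fun x _ => (hg.differentiable one_ne_zero) x)
      ((hg.continuous_deriv le_rfl).intervalIntegrable _ _), smul_eq_mul]
  field_simp

theorem integral_trig (a b c n φ p q : ℝ) (hn : n ≠ 0) :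
    ∫ τ in p..q, (a + b * Real.cos (2 * (n * τ + φ)) + c * Real.sin (2 * (n * τ + φ)))
      = (a * q + b / (2 * n) * Real.sin (2 * (n * q + φ)) - c / (2 * n) * Real.cos (2 * (n * q + φ)))
      - (a * p + b / (2 * n) * Real.sin (2 * (n * p + φ))
        - c / (2 * n) * Real.cos (2 * (n * p + φ))) := by
  refine intervalIntegral.integral_eq_sub_of_hasDerivAt (f := fun x => a * x +
    b / (2 * n) * Real.sin (2 * (n * x + φ)) - c / (2 * n) * Real.cos (2 * (n * x + φ)))
    (fun x _ => ?_) (by apply Continuous.intervalIntegrable; fun_prop)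
  have h : HasDerivAt (fun x => 2 * (n * x + φ)) (2 * n) x := by
    simpa using (((hasDerivAt_id x).const_mul n).add_const φ).const_mul 2
  refine ((((hasDerivAt_id x).const_mul a).add (h.sin.const_mul (b / (2 * n)))).sub
    (h.cos.const_mul (c / (2 * n)))).congr_deriv ?_
  field_simp
  ring

/-- The fundamental theorem of calculus applied to `u ↦ G₂(k,u)`, which is smooth and vanishes at `u
= 0` since its interval of integration degenerates there. So `H₂` is the mean of the field matrix
over one sampling interval. -/
theorem Orbit.H₂_apply (o : Orbit) (hR : o.R ≠ 0) (hn : o.n ≠ 0) (k : ℤ) {T : ℝ} (hT : T ≠ 0)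
    (i j : Fin 3) : o.H₂ k T i j = o.G₂ k T i j / T := by
  obtain ⟨a, b, c, h⟩ := o.exists_skew_Bi_eq hR
  have hG : (fun u => o.G₂ k u i j) = fun u => _ :=
    funext fun u => by
      simp only [Orbit.G₂, Matrix.of_apply, h]
      exact integral_trig _ _ _ _ _ _ _ hn
  have hsm : ContDiff ℝ 1 fun u => o.G₂ k u i j := by
    rw [hG]; fun_prop
  simp only [Orbit.H₂, Matrix.of_apply]
  rw [integral_deriv_comp_mul hsm hT]
  simp [Orbit.G₂]

/-- With `γ = 2nT` the phase advance per sample, averaging over a sampling interval mixes the two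
harmonic coefficients with weights `sin γ / γ` and `(1 - cos γ) / γ`. Then `L` is a sum of products
to which `hasMean_trig_mul` applies, and the explicit mean is available when `γ < π`. -/
theorem Orbit.exists_hasMean_L (o : Orbit) (hR : o.R ≠ 0) (hn : 0 < o.n) :
    ∃ a b c : Matrix (Fin 3) (Fin 3) ℝ, ∀ T > 0, ∀ i j, ∃ m, HasMean (fun k => o.L k T i j) m ∧
      (2 * o.n * T < Real.pi → m = ∑ l, (a i l * a j l +
        ((b i l * (Real.sin (2 * o.n * T) / (2 * o.n * T))
            + c i l * ((1 - Real.cos (2 * o.n * T)) / (2 * o.n * T))) * b j l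
          + (c i l * (Real.sin (2 * o.n * T) / (2 * o.n * T))
            - b i l * ((1 - Real.cos (2 * o.n * T)) / (2 * o.n * T))) * c j l) / 2)) := by
  obtain ⟨a, b, c, h⟩ := o.exists_skew_Bi_eq hR
  refine ⟨a, b, c, fun T hT i j => ?_⟩
  set γ := 2 * o.n * T with hγ
  have hγ0 : 0 < γ := by positivity
  have hH : ∀ (k : ℤ) l, o.H₂ k T i l = a i l
      + (b i l * (Real.sin γ / γ) + c i l * ((1 - Real.cos γ) / γ)) * Real.cos (γ * k + 2 * o.φ₀)
      + (c i l * (Real.sin γ / γ) - b i l * ((1 - Real.cos γ) / γ))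
        * Real.sin (γ * k + 2 * o.φ₀) := by
    intro k l
    rw [o.H₂_apply hR hn.ne' k hT.ne']
    simp only [Orbit.G₂, Matrix.of_apply, h]
    rw [integral_trig _ _ _ _ _ _ _ hn.ne',
      show 2 * (o.n * ((k + 1) * T) + o.φ₀) = (γ * k + 2 * o.φ₀) + γ by rw [hγ]; ring,
      show 2 * (o.n * (k * T) + o.φ₀) = γ * k + 2 * o.φ₀ by rw [hγ]; ring,
      Real.sin_add _ γ, Real.cos_add _ γ, show 2 * o.n = γ / T by rw [hγ]; field_simp]
    generalize γ * (k : ℝ) + 2 * o.φ₀ = x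
    field_simp
    ring
  choose m hm hm' using fun l => hasMean_trig_mul (a i l)
    (b i l * (Real.sin γ / γ) + c i l * ((1 - Real.cos γ) / γ))
    (c i l * (Real.sin γ / γ) - b i l * ((1 - Real.cos γ) / γ)) (a j l) (b j l) (c j l) γ
    (2 * o.φ₀)
  refine ⟨∑ l, m l, ?_, fun h1 => Finset.sum_congr rfl fun l _ => hm' l hγ0 h1⟩
  convert HasMean.sum Finset.univ fun l _ => hm l using 2 with k
  simp only [Orbit.L, Matrix.mul_apply, Matrix.transpose_apply, hH, h]
  rw [show 2 * (o.n * (k * T) + o.φ₀) = γ * k + 2 * o.φ₀ by rw [hγ]; ring]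

theorem Orbit.tendsto_meanL_of_hasMean (o : Orbit) {T : ℝ} {m : Matrix (Fin 3) (Fin 3) ℝ}
    (h : ∀ i j, HasMean (fun k => o.L k T i j) (m i j)) (s : ℤ) :
    Tendsto (o.meanL T s) atTop (𝓝 m) := by
  refine tendsto_pi_nhds.2 fun i => tendsto_pi_nhds.2 fun j => ?_
  refine ((h i j).tendsto s).congr fun N => ?_
  simp [Orbit.meanL, Matrix.sum_apply, sum_Icc_eq_sum_range]

theorem Orbit.hasMean_L (o : Orbit) (hR : o.R ≠ 0) (hn : 0 < o.n) {T : ℝ} (hT : 0 < T)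
    (i j : Fin 3) : HasMean (fun k => o.L k T i j) (o.Lav T i j) := by
  obtain ⟨a, b, c, h⟩ := o.exists_hasMean_L hR hn
  choose m hm _ using h T hT
  rw [show o.Lav T = m from (o.tendsto_meanL_of_hasMean hm 0).limUnder_eq]
  exact hm i j

theorem Orbit.tendsto_meanL (o : Orbit) (hR : o.R ≠ 0) (hn : 0 < o.n) {T : ℝ} (hT : 0 < T)
    (s : ℤ) : Tendsto (o.meanL T s) atTop (𝓝 (o.Lav T)) :=
  o.tendsto_meanL_of_hasMean (o.hasMean_L hR hn hT) s

theorem tendsto_sin_div_self : Tendsto (fun x : ℝ => Real.sin x / x) (𝓝[≠] 0) (𝓝 1) := by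
  have h := (Real.hasDerivAt_sin 0).tendsto_slope_zero
  simp only [zero_add, Real.sin_zero, sub_zero, Real.cos_zero, smul_eq_mul] at h
  exact h.congr fun x => by ring

theorem tendsto_one_sub_cos_div_self :
    Tendsto (fun x : ℝ => (1 - Real.cos x) / x) (𝓝[≠] 0) (𝓝 0) := by
  have h := (Real.hasDerivAt_cos 0).tendsto_slope_zero.neg
  simp only [zero_add, Real.cos_zero, Real.sin_zero, neg_zero, smul_eq_mul] at h
  exact h.congr fun x => by ring

theorem Orbit.tendsto_Lav (o : Orbit) (hR : o.R ≠ 0) (hn : 0 < o.n) :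
    Tendsto o.Lav (𝓝[>] (0 : ℝ)) (𝓝 o.Lav₀) := by
  obtain ⟨a, b, c, h⟩ := o.exists_hasMean_L hR hn
  have hγ : Tendsto (fun T => 2 * o.n * T) (𝓝[>] (0 : ℝ)) (𝓝[≠] 0) := by
    refine tendsto_nhdsWithin_iff.2 ⟨?_, ?_⟩
    · have : Tendsto (fun T => 2 * o.n * T) (𝓝 (0 : ℝ)) (𝓝 (2 * o.n * 0)) :=
        (continuous_const.mul continuous_id).tendsto 0
      rw [mul_zero] at this
      exact this.mono_left nhdsWithin_le_nhds
    · filter_upwards [self_mem_nhdsWithin] with T hT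
      have : 0 < T := hT
      have : 0 < 2 * o.n * T := by positivity
      exact this.ne'
  have hS := tendsto_sin_div_self.comp hγ
  have hD := tendsto_one_sub_cos_div_self.comp hγ
  suffices hlim : ∃ M, Tendsto o.Lav (𝓝[>] (0 : ℝ)) (𝓝 M) by
    obtain ⟨M, hM⟩ := hlim
    exact tendsto_nhds_limUnder ⟨M, hM⟩
  -- The factors `1` and `0` are the limits of `sin γ / γ` and `(1 - cos γ) / γ`.
  refine ⟨Matrix.of fun i j => ∑ l, (a i l * a j l + ((b i l * 1 + c i l * 0) * b j l
      + (c i l * 1 - b i l * 0) * c j l) / 2), ?_⟩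
  refine tendsto_pi_nhds.2 fun i => tendsto_pi_nhds.2 fun j => ?_
  have hsmall : ∀ᶠ T in 𝓝[>] (0 : ℝ), T < Real.pi / (2 * o.n) :=
    nhdsWithin_le_nhds (Iio_mem_nhds (by positivity))
  have := tendsto_finsetSum Finset.univ (fun l _ => (((((hS.const_mul (b i l)).add
    (hD.const_mul (c i l))).mul_const (b j l)).add (((hS.const_mul (c i l)).sub
    (hD.const_mul (b i l))).mul_const (c j l))).div_const 2).const_add (a i l * a j l))
  refine this.congr' ?_
  filter_upwards [hsmall, self_mem_nhdsWithin] with T h1 h2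
  obtain ⟨m, hm, hm'⟩ := h T h2 i j
  rw [(o.hasMean_L hR hn h2 i j).unique hm, hm' (by
    rw [lt_div_iff₀ (by positivity)] at h1; linarith)]
  rfl

/-! ### Quadratic forms and the Lyapunov equation. -/

section Lyapunov

variable {ι : Type*} [Fintype ι]

/-- The sum of the absolute values of the entries of a matrix. -/
def entrySum {κ : Type*} [Fintype κ] (M : Matrix ι κ ℝ) : ℝ := ∑ i, ∑ j, |M i j|

theorem entrySum_nonneg {κ : Type*} [Fintype κ] (M : Matrix ι κ ℝ) : 0 ≤ entrySum M :=
  Finset.sum_nonneg fun _ _ => Finset.sum_nonneg fun _ _ => abs_nonneg _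

theorem norm_mulVec_le_entrySum {κ : Type*} [Fintype κ] (M : Matrix ι κ ℝ) (x : κ → ℝ) :
    ‖M *ᵥ x‖ ≤ entrySum M * ‖x‖ := by
  refine (pi_norm_le_iff_of_nonneg (mul_nonneg (entrySum_nonneg M) (norm_nonneg x))).2 fun i => ?_
  calc ‖(M *ᵥ x) i‖ ≤ ∑ j, ‖M i j * x j‖ := norm_sum_le _ _
    _ ≤ ∑ j, |M i j| * ‖x‖ := Finset.sum_le_sum fun j _ => by
        rw [norm_mul]
        exact mul_le_mul_of_nonneg_left (norm_le_pi_norm x j) (norm_nonneg _)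
    _ = (∑ j, |M i j|) * ‖x‖ := by rw [Finset.sum_mul]
    _ ≤ entrySum M * ‖x‖ := mul_le_mul_of_nonneg_right
        (Finset.single_le_sum (f := fun i => ∑ j, |M i j|)
          (fun _ _ => Finset.sum_nonneg fun _ _ => abs_nonneg _) (Finset.mem_univ i))
        (norm_nonneg x)

theorem abs_dotProduct_mulVec_le (M : Matrix ι ι ℝ) (x y : ι → ℝ) :
    |x ⬝ᵥ M *ᵥ y| ≤ entrySum M * ‖x‖ * ‖y‖ := by
  rw [dotProduct]
  refine (Finset.abs_sum_le_sum_abs _ _).trans ?_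
  calc ∑ i, |x i * (M *ᵥ y) i| ≤ ∑ i, ‖x‖ * ((∑ j, |M i j|) * ‖y‖) :=
        Finset.sum_le_sum fun i _ => by
          rw [abs_mul]
          refine mul_le_mul (norm_le_pi_norm x i) ?_ (abs_nonneg _) (norm_nonneg _)
          rw [Matrix.mulVec, dotProduct, Finset.sum_mul]
          refine (Finset.abs_sum_le_sum_abs _ _).trans (Finset.sum_le_sum fun j _ => ?_)
          rw [abs_mul]
          exact mul_le_mul_of_nonneg_left (norm_le_pi_norm y j) (abs_nonneg _)
    _ = entrySum M * ‖x‖ * ‖y‖ := by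
        rw [← Finset.mul_sum, ← Finset.sum_mul, entrySum]; ring

theorem dotProduct_transpose_mulVec (M : Matrix ι ι ℝ) (x y : ι → ℝ) :
    x ⬝ᵥ Mᵀ *ᵥ y = y ⬝ᵥ M *ᵥ x := by
  rw [Matrix.mulVec_transpose, dotProduct_comm, Matrix.dotProduct_mulVec]

theorem dotProduct_mulVec_comm_of_symm {M : Matrix ι ι ℝ} (hM : Mᵀ = M) (x y : ι → ℝ) :
    x ⬝ᵥ M *ᵥ y = y ⬝ᵥ M *ᵥ x := by
  rw [← dotProduct_transpose_mulVec, hM]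

theorem continuous_quadForm (M : Matrix ι ι ℝ) : Continuous fun x : ι → ℝ => x ⬝ᵥ M *ᵥ x := by
  simp only [dotProduct, Matrix.mulVec]
  fun_prop

theorem posDef_iff_quadForm (M : Matrix ι ι ℝ) :
    M.PosDef ↔ Mᵀ = M ∧ ∀ x ≠ 0, 0 < x ⬝ᵥ M *ᵥ x := by
  rw [Matrix.posDef_iff_dotProduct_mulVec]
  simp [Matrix.IsHermitian, Matrix.conjTranspose_eq_transpose_of_trivial]

theorem quadForm_smul (M : Matrix ι ι ℝ) (r : ℝ) (x : ι → ℝ) :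
    (r • x) ⬝ᵥ M *ᵥ (r • x) = r ^ 2 * (x ⬝ᵥ M *ᵥ x) := by
  simp only [Matrix.mulVec_smul, smul_dotProduct, dotProduct_smul, smul_eq_mul]; ring

/-- Minimization of the Rayleigh quotient on the compact unit sphere; `r` is the minimum, and
homogeneity extends the bound to all vectors. -/
theorem exists_quadForm_minimizer [Nonempty ι] (P : Matrix ι ι ℝ) {Q : Matrix ι ι ℝ}
    (hQ : ∀ x ≠ 0, 0 < x ⬝ᵥ Q *ᵥ x) :
    ∃ v ≠ 0, ∃ r : ℝ, v ⬝ᵥ P *ᵥ v = r * (v ⬝ᵥ Q *ᵥ v) ∧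
      ∀ x, r * (x ⬝ᵥ Q *ᵥ x) ≤ x ⬝ᵥ P *ᵥ x := by
  have hne : ∀ x ∈ Metric.sphere (0 : ι → ℝ) 1, x ≠ 0 := by
    rintro x hx rfl
    simp at hx
  obtain ⟨v, hv, hmin⟩ := (isCompact_sphere (0 : ι → ℝ) 1).exists_isMinOn
    (NormedSpace.sphere_nonempty.2 zero_le_one)
    (f := fun x => (x ⬝ᵥ P *ᵥ x) / (x ⬝ᵥ Q *ᵥ x))
    ((continuous_quadForm P).continuousOn.div (continuous_quadForm Q).continuousOn
      fun x hx => (hQ x (hne x hx)).ne')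
  refine ⟨v, hne v hv, (v ⬝ᵥ P *ᵥ v) / (v ⬝ᵥ Q *ᵥ v), ?_, fun x => ?_⟩
  · rw [div_mul_cancel₀ _ (hQ v (hne v hv)).ne']
  · by_cases hx : x = 0
    · simp [hx]
    have hx' : 0 < ‖x‖ := norm_pos_iff.2 hx
    have hy : ‖x‖⁻¹ • x ∈ Metric.sphere (0 : ι → ℝ) 1 := by
      simp [norm_smul, hx'.ne']
    have h := hmin hy
    simp only [mem_ofPred_eq, quadForm_smul] at h
    rw [mul_div_mul_left _ _ (by positivity)] at h
    rwa [← le_div_iff₀ (hQ x hx)]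

theorem exists_pos_mul_sq_norm_le_quadForm {Q : Matrix ι ι ℝ} (hQ : ∀ x ≠ 0, 0 < x ⬝ᵥ Q *ᵥ x) :
    ∃ c > 0, ∀ x, c * ‖x‖ ^ 2 ≤ x ⬝ᵥ Q *ᵥ x := by
  cases isEmpty_or_nonempty ι
  · exact ⟨1, one_pos, fun x => by simp [Subsingleton.elim x 0]⟩
  obtain ⟨v, hv, hmin⟩ := (isCompact_sphere (0 : ι → ℝ) 1).exists_isMinOn
    (NormedSpace.sphere_nonempty.2 zero_le_one) (continuous_quadForm Q).continuousOn
  have hv0 : v ≠ 0 := by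
    rintro rfl
    simp at hv
  refine ⟨v ⬝ᵥ Q *ᵥ v, hQ v hv0, fun x => ?_⟩
  by_cases hx : x = 0
  · simp [hx]
  have hx' : 0 < ‖x‖ := norm_pos_iff.2 hx
  have hy : ‖x‖⁻¹ • x ∈ Metric.sphere (0 : ι → ℝ) 1 := by
    simp [norm_smul, hx'.ne']
  have h := hmin hy
  simp only [mem_ofPred_eq, quadForm_smul, inv_pow] at h
  rwa [inv_mul_eq_div, le_div_iff₀ (by positivity)] at h

/-- `P - r Q` is positive semidefinite and its form vanishes at `v`, hence it annihilates `v`. Thus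
`P v = r Q v`, and `P` can be exchanged for `r Q` in the Lyapunov form at `v`. -/
theorem exists_lyapunov_minimizer [Nonempty ι] {P Q A : Matrix ι ι ℝ} (hP : Pᵀ = P)
    (hQ : Q.PosDef) :
    ∃ v ≠ 0, ∃ r : ℝ, v ⬝ᵥ (P * A + Aᵀ * P) *ᵥ v = 2 * r * (v ⬝ᵥ (Q * A) *ᵥ v) ∧
      ∀ x, r * (x ⬝ᵥ Q *ᵥ x) ≤ x ⬝ᵥ P *ᵥ x := by
  obtain ⟨hQs, hQp⟩ := (posDef_iff_quadForm Q).1 hQ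
  obtain ⟨v, hv, r, hvr, hr⟩ := exists_quadForm_minimizer P hQp
  refine ⟨v, hv, r, ?_, hr⟩
  have hpsd : (P - r • Q).PosSemidef := by
    refine .of_dotProduct_mulVec_nonneg ?_ fun x => ?_
    · simp [Matrix.IsHermitian, hP, hQs]
    · simpa [Matrix.sub_mulVec, dotProduct_sub, Matrix.smul_mulVec] using hr x
  have hker : (P - r • Q) *ᵥ v = 0 := by
    rw [← hpsd.dotProduct_mulVec_zero_iff]
    simp [Matrix.sub_mulVec, dotProduct_sub, Matrix.smul_mulVec, hvr]
  have hPv : P *ᵥ v = r • Q *ᵥ v := by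
    rwa [Matrix.sub_mulVec, Matrix.smul_mulVec, sub_eq_zero] at hker
  rw [Matrix.add_mulVec, dotProduct_add, ← Matrix.mulVec_mulVec, ← Matrix.mulVec_mulVec,
    ← Matrix.mulVec_mulVec, dotProduct_transpose_mulVec, dotProduct_comm (P *ᵥ v),
    dotProduct_mulVec_comm_of_symm hP, hPv,
    dotProduct_smul, dotProduct_mulVec_comm_of_symm hQs, smul_eq_mul]
  ring

/-- If `P` is in the kernel of the Lyapunov operator on symmetric matrices, the minimizer identity
forces `r = 0`, so `P ≥ 0`; the same holds for `-P`, so `P = 0`. Injectivity gives surjectivity in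
finite dimension. For the preimage of `-1` the identity reads `-v·v = 2 r (v·QAv)`, so `r > 0` and
`P ≥ r Q` is positive definite. -/
theorem exists_lyapunov_solution [DecidableEq ι] [Nonempty ι] {Q A : Matrix ι ι ℝ} (hQ : Q.PosDef)
    (hA : ∀ x ≠ 0, x ⬝ᵥ (Q * A) *ᵥ x < 0) :
    ∃ P : Matrix ι ι ℝ, P.PosDef ∧ P * A + Aᵀ * P = -1 := by
  obtain ⟨hQs, hQp⟩ := (posDef_iff_quadForm Q).1 hQ
  let S : Submodule ℝ (Matrix ι ι ℝ) :=
    { carrier := {P | Pᵀ = P}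
      add_mem' := fun {a b} (ha : aᵀ = a) (hb : bᵀ = b) => by simp [ha, hb]
      zero_mem' := by simp
      smul_mem' := fun c a (ha : aᵀ = a) => by simp [ha] }
  let F : S →ₗ[ℝ] S :=
    { toFun := fun P => ⟨P.1 * A + Aᵀ * P.1, by
        have hP : P.1ᵀ = P.1 := P.2
        change (P.1 * A + Aᵀ * P.1)ᵀ = _
        simp [hP, add_comm]⟩
      map_add' := fun P R => by
        ext1; simp only [Submodule.coe_add, add_mul, mul_add]; abel
      map_smul' := fun c P => by
        ext1; simp }
  have hnonneg : ∀ P : S, F P = 0 → ∀ x, 0 ≤ x ⬝ᵥ P.1 *ᵥ x := by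
    intro P hP x
    obtain ⟨v, hv, r, hvr, hr⟩ := exists_lyapunov_minimizer (A := A) (show P.1ᵀ = P.1 from P.2) hQ
    have h0 : P.1 * A + Aᵀ * P.1 = 0 := congrArg Subtype.val hP
    rw [h0, Matrix.zero_mulVec, dotProduct_zero] at hvr
    have : r = 0 := by simpa [(hA v hv).ne] using hvr.symm
    simpa [this] using hr x
  have hinj : Function.Injective F := by
    rw [injective_iff_map_eq_zero]
    intro P hP
    have h1 := hnonneg P hP
    have h2 := hnonneg (-P) (by rw [map_neg, hP, neg_zero])
    have hpsd : P.1.PosSemidef :=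
      .of_dotProduct_mulVec_nonneg (show P.1ᵀ = P.1 from P.2) (by simpa using h1)
    ext1
    refine Matrix.ext_of_mulVec_single fun i => ?_
    have h3 := h2 (Pi.single i 1)
    rw [Submodule.coe_neg, Matrix.neg_mulVec, dotProduct_neg] at h3
    have := (hpsd.dotProduct_mulVec_zero_iff (Pi.single i 1)).1 (by
      simpa using le_antisymm (by linarith) (h1 (Pi.single i 1)))
    change _ = (0 : Matrix ι ι ℝ) *ᵥ _
    rw [this, Matrix.zero_mulVec]
  obtain ⟨P, hP⟩ := LinearMap.injective_iff_surjective.1 hinj ⟨-1, by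
    change (-1 : Matrix ι ι ℝ)ᵀ = -1
    simp⟩
  have hPL : P.1 * A + Aᵀ * P.1 = -1 := congrArg Subtype.val hP
  refine ⟨P.1, (posDef_iff_quadForm _).2 ⟨P.2, fun x hx => ?_⟩, hPL⟩
  obtain ⟨v, hv, r, hvr, hr⟩ := exists_lyapunov_minimizer (A := A) (show P.1ᵀ = P.1 from P.2) hQ
  rw [hPL, Matrix.neg_mulVec, Matrix.one_mulVec, dotProduct_neg] at hvr
  have hvv : 0 < v ⬝ᵥ v := by
    simpa using Matrix.dotProduct_star_self_pos_iff.2 hv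
  have hr0 : 0 < r := by
    by_contra! h
    nlinarith [mul_nonneg_of_nonpos_of_nonpos h (hA v hv).le]
  exact (mul_pos hr0 (hQp x hx)).trans_le (hr x)

end Lyapunov

/-! ### A strict Lyapunov function for the averaged system. -/

/-- The matrix `A_s` as a function of the averaged matrix `L_av`. -/
def averagedMatrix (J : Matrix (Fin 3) (Fin 3) ℝ) (k₁ k₂ : ℝ) (M : Matrix (Fin 3) (Fin 3) ℝ) :
    Matrix (Fin 3 ⊕ Fin 3) (Fin 3 ⊕ Fin 3) ℝ :=
  Matrix.fromBlocks 0 ((1 / 2 : ℝ) • 1) (-(k₁ • (J⁻¹ * M))) (-(k₂ • (J⁻¹ * M)))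

theorem continuous_averagedMatrix (J : Matrix (Fin 3) (Fin 3) ℝ) (k₁ k₂ : ℝ) :
    Continuous (averagedMatrix J k₁ k₂) :=
  Continuous.matrix_fromBlocks continuous_const continuous_const (by fun_prop) (by fun_prop)

theorem norm_sumElim {ι κ : Type*} [Fintype ι] [Fintype κ] (u : ι → ℝ) (w : κ → ℝ) :
    ‖Sum.elim u w‖ = max ‖u‖ ‖w‖ := by
  refine le_antisymm ?_ (max_le ?_ ?_)
  · refine (pi_norm_le_iff_of_nonneg (by positivity)).2 ?_
    rintro (i | i)
    · exact (norm_le_pi_norm u i).trans (le_max_left _ _)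
    · exact (norm_le_pi_norm w i).trans (le_max_right _ _)
  · exact (pi_norm_le_iff_of_nonneg (norm_nonneg _)).2 fun i =>
      norm_le_pi_norm (Sum.elim u w) (Sum.inl i)
  · exact (pi_norm_le_iff_of_nonneg (norm_nonneg _)).2 fun i =>
      norm_le_pi_norm (Sum.elim u w) (Sum.inr i)

/-- The form is a mechanical energy plus a cross term of weight `c` coupling attitude and velocity.
The coefficient `k₁ + c k₂` is chosen so that, by symmetry of `M`, the mixed terms of the derivative
cancel. What remains is `-(c k₁/2) u·Mu - (k₂/2) w·Mw + (c/4) w·Jw`, which is negative for small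
`c`. -/
theorem exists_lyapunov_averagedMatrix {J M : Matrix (Fin 3) (Fin 3) ℝ} (hJ : J.PosDef)
    (hM : M.PosDef) {k₁ k₂ : ℝ} (hk₁ : 0 < k₁) (hk₂ : 0 < k₂) :
    ∃ Q : Matrix (Fin 3 ⊕ Fin 3) (Fin 3 ⊕ Fin 3) ℝ, Q.PosDef ∧
      ∀ x ≠ 0, x ⬝ᵥ (Q * averagedMatrix J k₁ k₂ M) *ᵥ x < 0 := by
  obtain ⟨hJs, hJp⟩ := (posDef_iff_quadForm J).1 hJ
  obtain ⟨hMs, hMp⟩ := (posDef_iff_quadForm M).1 hM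
  obtain ⟨j, hj, hJj⟩ := exists_pos_mul_sq_norm_le_quadForm hJp
  obtain ⟨l, hl, hMl⟩ := exists_pos_mul_sq_norm_le_quadForm hMp
  have hJJ : J * J⁻¹ = 1 := Matrix.mul_nonsing_inv _ hJ.det_pos.ne'.isUnit
  set C := entrySum J + 1
  have hC : 0 < C := by have := entrySum_nonneg J; positivity
  have hJC : ∀ u w, |u ⬝ᵥ J *ᵥ w| ≤ C * ‖u‖ * ‖w‖ := fun u w =>
    (abs_dotProduct_mulVec_le J u w).trans (by gcongr; simp [C])
  -- With `c = d / C` the cross term is at most `d ‖u‖ ‖w‖`. The bound `k₂ l / 2` serves the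
  -- decrease; the other two give `d² ≤ k₁ l j`, which makes the form positive definite.
  set d := min (k₂ * l / 2) (min 1 (k₁ * l * j))
  have hd : 0 < d := by positivity
  have hd1 : d ≤ k₂ * l / 2 := min_le_left _ _
  have hd2 : d ≤ 1 := (min_le_right _ _).trans (min_le_left _ _)
  have hd3 : d ≤ k₁ * l * j := (min_le_right _ _).trans (min_le_right _ _)
  set c := d / C
  have hc : 0 < c := by positivity
  have hcC : c * C = d := div_mul_cancel₀ _ hC.ne'
  have helim : ∀ x : Fin 3 ⊕ Fin 3 → ℝ, x ≠ 0 → ∃ u w : Fin 3 → ℝ, x = Sum.elim u w ∧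
      (0 < ‖u‖ ∨ 0 < ‖w‖) := by
    intro x hx
    refine ⟨x ∘ Sum.inl, x ∘ Sum.inr, (Sum.elim_comp_inl_inr x).symm, ?_⟩
    have := norm_pos_iff.2 hx
    rwa [← Sum.elim_comp_inl_inr x, norm_sumElim, lt_max_iff] at this
  refine ⟨Matrix.fromBlocks ((k₁ + c * k₂) • M) ((c / 2) • J) ((c / 2) • J) ((1 / 2 : ℝ) • J),
    (posDef_iff_quadForm _).2 ⟨?_, fun x hx => ?_⟩, fun x hx => ?_⟩
  · rw [Matrix.fromBlocks_transpose]
    simp [hJs, hMs]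
  · obtain ⟨u, w, rfl, huw⟩ := helim x hx
    rw [Matrix.fromBlocks_mulVec, sumElim_dotProduct_sumElim]
    simp only [Sum.elim_comp_inl, Sum.elim_comp_inr, Matrix.smul_mulVec, dotProduct_add,
      dotProduct_smul, smul_eq_mul]
    rw [dotProduct_mulVec_comm_of_symm hJs w u]
    have h1 : c * |u ⬝ᵥ J *ᵥ w| ≤ d * ‖u‖ * ‖w‖ := by
      have := mul_le_mul_of_nonneg_left (hJC u w) hc.le
      rwa [← mul_assoc, ← mul_assoc, hcC] at this
    have h2 : -(c * |u ⬝ᵥ J *ᵥ w|) ≤ c * (u ⬝ᵥ J *ᵥ w) := by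
      rw [← mul_neg]; exact mul_le_mul_of_nonneg_left (neg_abs_le _) hc.le
    have h3 : k₁ * (l * ‖u‖ ^ 2) ≤ k₁ * (u ⬝ᵥ M *ᵥ u) := mul_le_mul_of_nonneg_left (hMl u) hk₁.le
    have h4 : 0 ≤ c * k₂ * (u ⬝ᵥ M *ᵥ u) :=
      mul_nonneg (by positivity) ((by positivity : 0 ≤ l * ‖u‖ ^ 2).trans (hMl u))
    have h5 := hJj w
    have h6 : 0 < k₁ * l * ‖u‖ ^ 2 - d * ‖u‖ * ‖w‖ + j / 2 * ‖w‖ ^ 2 := by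
      have hkl : 0 < k₁ * l := by positivity
      have : 0 < 4 * (k₁ * l) * (k₁ * l * ‖u‖ ^ 2 - d * ‖u‖ * ‖w‖ + j / 2 * ‖w‖ ^ 2) := by
        have hdd : d ^ 2 ≤ k₁ * l * j := by nlinarith
        have e : 4 * (k₁ * l) * (k₁ * l * ‖u‖ ^ 2 - d * ‖u‖ * ‖w‖ + j / 2 * ‖w‖ ^ 2)
          = (2 * (k₁ * l) * ‖u‖ - d * ‖w‖) ^ 2 + (2 * (k₁ * l * j) - d ^ 2) * ‖w‖ ^ 2 := by ring
        rw [e]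
        have hkj : 0 < k₁ * l * j := by positivity
        rcases (norm_nonneg w).eq_or_lt with hw | hw
        · rw [← hw] at huw ⊢
          have hu : 0 < ‖u‖ := by simpa using huw
          simp only [mul_zero, sub_zero, ne_eq, OfNat.ofNat_ne_zero, not_false_eq_true, zero_pow,
            add_zero]
          positivity
        · have : 0 < (2 * (k₁ * l * j) - d ^ 2) * ‖w‖ ^ 2 := mul_pos (by linarith) (by positivity)
          positivity
      exact pos_of_mul_pos_right this (by positivity)
    linarith
  · obtain ⟨u, w, rfl, huw⟩ := helim x hx
    rw [averagedMatrix, Matrix.fromBlocks_multiply, Matrix.fromBlocks_mulVec,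
      sumElim_dotProduct_sumElim]
    have e : ∀ a b : ℝ, (a • J) * -(b • (J⁻¹ * M)) = (-(a * b)) • M := fun a b => by
      rw [mul_neg, Matrix.smul_mul, Matrix.mul_smul, ← Matrix.mul_assoc, hJJ, Matrix.one_mul,
        smul_smul, neg_smul]
    simp only [e, Sum.elim_comp_inl, Sum.elim_comp_inr, Matrix.smul_mulVec, dotProduct_add,
      dotProduct_smul, smul_eq_mul, Matrix.mul_zero, Matrix.mul_smul, Matrix.mul_one, zero_add,
      Matrix.add_mulVec]
    rw [dotProduct_mulVec_comm_of_symm hMs w u]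
    have h1 : c * |w ⬝ᵥ J *ᵥ w| ≤ d * ‖w‖ * ‖w‖ := by
      have := mul_le_mul_of_nonneg_left (hJC w w) hc.le
      rwa [← mul_assoc, ← mul_assoc, hcC] at this
    have h2 : c * (w ⬝ᵥ J *ᵥ w) ≤ c * |w ⬝ᵥ J *ᵥ w| := mul_le_mul_of_nonneg_left (le_abs_self _) hc.le
    have h3 : c * k₁ * (l * ‖u‖ ^ 2) ≤ c * k₁ * (u ⬝ᵥ M *ᵥ u) :=
      mul_le_mul_of_nonneg_left (hMl u) (by positivity)
    have h4 : k₂ * (l * ‖w‖ ^ 2) ≤ k₂ * (w ⬝ᵥ M *ᵥ w) := mul_le_mul_of_nonneg_left (hMl w) hk₂.le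
    have h5 : d * ‖w‖ * ‖w‖ ≤ k₂ * l / 2 * ‖w‖ * ‖w‖ := by gcongr
    have h6 : 0 < 2 * (c * k₁ * (l * ‖u‖ ^ 2)) + k₂ * (l * ‖w‖ ^ 2) := by
      rcases huw with h | h <;> positivity
    nlinarith

/-- The form `Q` built for the symmetric limit `M` is kept fixed. Strict negativity of `Q A` is an
open condition, so it persists for nearby `f a`, which need not be symmetric. -/
theorem eventually_exists_lyapunov {α : Type*} {F : Filter α} {f : α → Matrix (Fin 3) (Fin 3) ℝ}
    {J M : Matrix (Fin 3) (Fin 3) ℝ} (hf : Tendsto f F (𝓝 M)) (hJ : J.PosDef)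
    (hM : M.PosDef) {k₁ k₂ : ℝ} (hk₁ : 0 < k₁) (hk₂ : 0 < k₂) :
    ∀ᶠ a in F, ∃ P, IsLyapunovSolution (averagedMatrix J k₁ k₂ (f a)) P := by
  obtain ⟨Q, hQ, hneg⟩ := exists_lyapunov_averagedMatrix hJ hM hk₁ hk₂
  obtain ⟨c, hc, hcx⟩ := exists_pos_mul_sq_norm_le_quadForm
    (Q := -(Q * averagedMatrix J k₁ k₂ M)) fun x hx => by
      rw [Matrix.neg_mulVec, dotProduct_neg]; exact neg_pos.2 (hneg x hx)
  have hcont : Continuous fun N => entrySum (Q * averagedMatrix J k₁ k₂ N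
      - Q * averagedMatrix J k₁ k₂ M) := by
    have := continuous_averagedMatrix J k₁ k₂
    have h2 : Continuous fun N => Q * averagedMatrix J k₁ k₂ N - Q * averagedMatrix J k₁ k₂ M := by
      fun_prop
    exact continuous_finsetSum _ fun i _ => continuous_finsetSum _ fun j _ =>
      (h2.matrix_elem i j).abs
  have h0 := (hcont.tendsto M).comp hf
  simp only [sub_self] at h0
  filter_upwards [h0.eventually_lt_const (show entrySum (0 : Matrix (Fin 3 ⊕ Fin 3) (Fin 3 ⊕ Fin 3) ℝ)
    < c by simpa [entrySum] using hc)] with a ha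
  refine exists_lyapunov_solution hQ fun x hx => ?_
  have h1 := hcx x
  have h2 := (le_abs_self _).trans (abs_dotProduct_mulVec_le (Q * averagedMatrix J k₁ k₂ (f a)
      - Q * averagedMatrix J k₁ k₂ M) x x)
  rw [Matrix.sub_mulVec, dotProduct_sub] at h2
  rw [Matrix.neg_mulVec, dotProduct_neg] at h1
  have h3 : 0 < ‖x‖ := norm_pos_iff.2 hx
  have h4 := mul_lt_mul_of_pos_right ha (by positivity : 0 < ‖x‖ * ‖x‖)
  simp only [Function.comp] at h4
  nlinarith

/-! ### Averaging for slowly varying recursions. -/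

section DiscreteAveraging

variable {ι : Type*} [Fintype ι]

theorem norm_mulVec_le_of_entrySum_le {M : Matrix ι ι ℝ} {B : ℝ} (h : entrySum M ≤ B) (x : ι → ℝ) :
    ‖M *ᵥ x‖ ≤ B * ‖x‖ :=
  (norm_mulVec_le_entrySum M x).trans (mul_le_mul_of_nonneg_right h (norm_nonneg x))

/-- The remainder of one step of a slowly varying recursion in the averaged coordinate
`x - h S x`. -/
theorem norm_averaged_step_le {A S S' : Matrix ι ι ℝ} {B C ε T : ℝ} {x x' : ι → ℝ} (hT : 0 < T)
    (hε : 0 < ε) (hS : entrySum S ≤ B) (hS' : entrySum S' ≤ B)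
    (hεB : ε * T * B ≤ 1 / 2)
    (hx : ‖x' - x - (ε * T) • (A *ᵥ x + S' *ᵥ x - S *ᵥ x)‖ ≤ C * ε * (ε * ‖x‖ + ‖x‖ ^ 2)) :
    ‖(x' - (ε * T) • S' *ᵥ x') - (x - (ε * T) • S *ᵥ x)
        - (ε * T) • A *ᵥ (x - (ε * T) • S *ᵥ x)‖
      ≤ (T ^ 2 * (2 * entrySum A * B + 2 * B ^ 2) + 2 * C) * ε * (ε * ‖x‖ + ‖x‖ ^ 2) := by
  set a := entrySum A
  set h := ε * T
  have ha : 0 ≤ a := entrySum_nonneg A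
  have hB : 0 ≤ B := (entrySum_nonneg S).trans hS
  have hh : 0 < h := by positivity
  set g := x' - x - h • (A *ᵥ x + S' *ᵥ x - S *ᵥ x) with hg
  have hx' : x' = x + h • (A *ᵥ x + S' *ᵥ x - S *ᵥ x) + g := by rw [hg]; abel
  have hA := norm_mulVec_le_entrySum A x
  have hSx := norm_mulVec_le_of_entrySum_le hS x
  have hSx' := norm_mulVec_le_of_entrySum_le hS' x
  have hdiff : ‖x' - x‖ ≤ h * ((a + 2 * B) * ‖x‖) + ‖g‖ := by
    rw [show x' - x = h • (A *ᵥ x + S' *ᵥ x - S *ᵥ x) + g by rw [hg]; abel]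
    refine (norm_add_le _ _).trans (add_le_add_left ?_ _)
    rw [norm_smul, Real.norm_eq_abs, abs_of_pos hh]
    refine mul_le_mul_of_nonneg_left ?_ hh.le
    have h1 := norm_sub_le (A *ᵥ x + S' *ᵥ x) (S *ᵥ x)
    have h2 := norm_add_le (A *ᵥ x) (S' *ᵥ x)
    linarith
  -- The terms `S' x - S x` of order `h` cancel; the defect is of order `h²` apart from `g`.
  have e : (x' - h • S' *ᵥ x') - (x - h • S *ᵥ x) - h • A *ᵥ (x - h • S *ᵥ x)
      = h • (h • A *ᵥ (S *ᵥ x)) + g - h • S' *ᵥ (x' - x) := by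
    simp only [hg, Matrix.mulVec_sub, Matrix.mulVec_smul]
    module
  rw [e]
  have n1 : ‖h • (h • A *ᵥ (S *ᵥ x))‖ ≤ h * (h * (a * (B * ‖x‖))) := by
    rw [norm_smul, norm_smul, Real.norm_eq_abs, abs_of_pos hh]
    have := (norm_mulVec_le_entrySum A (S *ᵥ x)).trans (mul_le_mul_of_nonneg_left hSx ha)
    gcongr
  have n2 : ‖h • S' *ᵥ (x' - x)‖ ≤ h * (B * (h * ((a + 2 * B) * ‖x‖) + ‖g‖)) := by
    rw [norm_smul, Real.norm_eq_abs, abs_of_pos hh]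
    have := (norm_mulVec_le_of_entrySum_le hS' (x' - x)).trans (mul_le_mul_of_nonneg_left hdiff hB)
    gcongr
  have n3 : h * B * ‖g‖ ≤ 1 * ‖g‖ := mul_le_mul_of_nonneg_right (by linarith) (norm_nonneg g)
  have n4 : 0 ≤ T ^ 2 * (2 * a * B + 2 * B ^ 2) * ε * ‖x‖ ^ 2 := by positivity
  calc _ ≤ ‖h • (h • A *ᵥ (S *ᵥ x))‖ + ‖g‖ + ‖h • S' *ᵥ (x' - x)‖ :=
        (norm_sub_le _ _).trans (add_le_add_left (norm_add_le _ _) _)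
    _ ≤ h ^ 2 * (2 * a * B + 2 * B ^ 2) * ‖x‖ + 2 * ‖g‖ := by nlinarith
    _ ≤ h ^ 2 * (2 * a * B + 2 * B ^ 2) * ‖x‖ + 2 * (C * ε * (ε * ‖x‖ + ‖x‖ ^ 2)) := by gcongr
    _ = T ^ 2 * (2 * a * B + 2 * B ^ 2) * ε * (ε * ‖x‖) + 2 * (C * ε * (ε * ‖x‖ + ‖x‖ ^ 2)) := by
        simp only [h]; ring
    _ ≤ _ := by nlinarith

/-- Decrease of a quadratic Lyapunov function along a perturbed Euler step. -/
theorem quadForm_step_le {P A : Matrix ι ι ℝ} {b D η μ ε T : ℝ} {y y' : ι → ℝ} (hP : Pᵀ = P)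
    (hA : ∀ x, 2 * (x ⬝ᵥ (P * A) *ᵥ x) ≤ -η * ‖x‖ ^ 2) (hb : entrySum P ≤ b)
    (hT : 0 < T) (hε : 0 < ε) (hD : 0 ≤ D) (hμ1 : μ ≤ 1)
    (hμ : μ * (2 * b * D + b * (T * entrySum A + D) ^ 2) ≤ T * η / 2)
    (hεy : ε + ‖y‖ ≤ μ)
    (hy : ‖y' - y - (ε * T) • A *ᵥ y‖ ≤ D * ε * (ε * ‖y‖ + ‖y‖ ^ 2)) :
    y' ⬝ᵥ P *ᵥ y' ≤ y ⬝ᵥ P *ᵥ y - ε * (T * η / 2) * ‖y‖ ^ 2 := by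
  set a := entrySum A
  have ha : 0 ≤ a := entrySum_nonneg A
  have hb0 : 0 ≤ b := (entrySum_nonneg P).trans hb
  set r := y' - y - (ε * T) • A *ᵥ y with hr
  have hr1 : ‖r‖ ≤ ε * (D * μ) * ‖y‖ := by
    refine hy.trans ?_
    have : D * ε * ((ε + ‖y‖) * ‖y‖) ≤ D * ε * (μ * ‖y‖) := by gcongr
    linarith
  set z := (ε * T) • A *ᵥ y + r with hz
  have hz1 : ‖z‖ ≤ ε * (T * a + D) * ‖y‖ := by
    refine (norm_add_le _ _).trans ?_
    rw [norm_smul, Real.norm_eq_abs, abs_of_pos (by positivity)]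
    have h1 := mul_le_mul_of_nonneg_left (norm_mulVec_le_entrySum A y) (by positivity : 0 ≤ ε * T)
    have h2 : ε * (D * μ) * ‖y‖ ≤ ε * (D * 1) * ‖y‖ := by gcongr
    have h3 : ε * T * (a * ‖y‖) = ε * (T * a) * ‖y‖ := by ring
    linarith
  have hy' : y' = y + z := by rw [hz, hr]; abel
  have hyz : y ⬝ᵥ P *ᵥ z = ε * T * (y ⬝ᵥ (P * A) *ᵥ y) + y ⬝ᵥ P *ᵥ r := by
    rw [hz, Matrix.mulVec_add, dotProduct_add, Matrix.mulVec_smul, dotProduct_smul,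
      Matrix.mulVec_mulVec, smul_eq_mul]
  have e : y' ⬝ᵥ P *ᵥ y' = y ⬝ᵥ P *ᵥ y + 2 * (y ⬝ᵥ P *ᵥ z) + z ⬝ᵥ P *ᵥ z := by
    rw [hy', Matrix.mulVec_add, dotProduct_add, add_dotProduct y z, add_dotProduct y z,
      dotProduct_mulVec_comm_of_symm hP z y]
    ring
  have b1 : y ⬝ᵥ P *ᵥ r ≤ b * ‖y‖ * (ε * (D * μ) * ‖y‖) := by
    refine ((le_abs_self _).trans (abs_dotProduct_mulVec_le P y r)).trans ?_
    gcongr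
  have b2 : z ⬝ᵥ P *ᵥ z ≤ b * (ε * (T * a + D) * ‖y‖) * (ε * (T * a + D) * ‖y‖) := by
    refine ((le_abs_self _).trans (abs_dotProduct_mulVec_le P z z)).trans ?_
    gcongr
  have b3 := mul_le_mul_of_nonneg_left (hA y) (by positivity : 0 ≤ ε * T)
  have hεμ : ε ≤ μ := by linarith [norm_nonneg y]
  have b4 : b * (ε * (T * a + D) * ‖y‖) * (ε * (T * a + D) * ‖y‖)
      ≤ ε * (μ * (b * (T * a + D) ^ 2)) * ‖y‖ ^ 2 := by
    have : ε * (ε * (b * (T * a + D) ^ 2)) * ‖y‖ ^ 2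
      ≤ ε * (μ * (b * (T * a + D) ^ 2)) * ‖y‖ ^ 2 := by gcongr
    linarith
  -- The remainder and the term quadratic in the increment use up at most half of the first-order
  -- decrease `ε T η ‖y‖²`.
  have b5 : ε * (μ * (2 * b * D + b * (T * a + D) ^ 2)) * ‖y‖ ^ 2 ≤ ε * (T * η / 2) * ‖y‖ ^ 2 := by
    gcongr
  rw [e, hyz]
  linarith

/-- Exponential stability by averaging for a slowly varying, perturbed linear recursion with the
coefficient matrices `A + (S (k + 1) - S k)`, where `S` is bounded. The predicate `Q` stands for the
validity of the recursion. -/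
theorem exists_discrete_averaging {P A : Matrix ι ι ℝ} (hP : P.PosDef) {η : ℝ} (hη : 0 < η)
    (hA : ∀ x, 2 * (x ⬝ᵥ (P * A) *ᵥ x) ≤ -η * ‖x‖ ^ 2) {T B C ρ : ℝ} (hT : 0 < T) (hB : 0 ≤ B)
    (hC : 0 ≤ C) (hρ : 0 < ρ) :
    ∃ ε₁ > 0, ∀ ε, 0 < ε → ε ≤ ε₁ → ∃ δ > 0, ∃ K > 0, ∃ κ, 0 < κ ∧ κ < 1 ∧
      ∀ (S : ℕ → Matrix ι ι ℝ) (x : ℕ → ι → ℝ) (Q : ℕ → Prop), (∀ k, entrySum (S k) ≤ B) →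
        Q 0 → ‖x 0‖ ≤ δ →
        (∀ k, Q k → ‖x k‖ ≤ ρ → Q (k + 1) ∧
          ‖x (k + 1) - x k - (ε * T) • (A *ᵥ x k + S (k + 1) *ᵥ x k - S k *ᵥ x k)‖
            ≤ C * ε * (ε * ‖x k‖ + ‖x k‖ ^ 2)) →
        ∀ k, Q k ∧ ‖x k‖ ≤ ρ ∧ ‖x k‖ ≤ K * κ ^ k * ‖x 0‖ := by
  obtain ⟨hPs, hPp⟩ := (posDef_iff_quadForm P).1 hP
  obtain ⟨c, hc, hcP⟩ := exists_pos_mul_sq_norm_le_quadForm hPp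
  set a := entrySum A
  have ha : 0 ≤ a := entrySum_nonneg A
  set b := entrySum P + 1
  have hb : 0 < b := by have := entrySum_nonneg P; positivity
  have hbP : ∀ y, y ⬝ᵥ P *ᵥ y ≤ b * ‖y‖ ^ 2 := fun y => by
    refine ((le_abs_self _).trans (abs_dotProduct_mulVec_le P y y)).trans ?_
    rw [mul_assoc, ← sq]
    gcongr
    simp [b]
  -- The factor 4 pays for replacing `‖x‖` by `2 ‖y‖` in a quadratic remainder.
  set D := 4 * (T ^ 2 * (2 * a * B + 2 * B ^ 2) + 2 * C)
  have hD : 0 ≤ D := by positivity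
  set M := 2 * b * D + b * (T * a + D) ^ 2
  have hM : 0 ≤ M := by positivity
  set μ := min 1 (T * η / 2 / (M + 1))
  have hμ0 : 0 < μ := by positivity
  have hμ1 : μ ≤ 1 := min_le_left _ _
  have hμM : μ * M ≤ T * η / 2 := by
    have h1 : μ ≤ T * η / 2 / (M + 1) := min_le_right _ _
    rw [le_div_iff₀ (by positivity)] at h1
    linarith
  -- The three bounds leave `‖y‖` the room `μ / 2`, make `x` and `y` comparable within a factor 2,
  -- and keep the contraction factor `κ₂` positive.
  refine ⟨min (μ / 2) (min (1 / (2 * (T * B + 1))) (b / (T * η))), by positivity,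
    fun ε hε hε1 => ?_⟩
  have hε2 : ε ≤ μ / 2 := hε1.trans (min_le_left _ _)
  have hεB : ε * T * B ≤ 1 / 2 := by
    have h1 : ε ≤ 1 / (2 * (T * B + 1)) :=
      hε1.trans ((min_le_right _ _).trans (min_le_left _ _))
    rw [le_div_iff₀ (by positivity)] at h1
    linarith
  have hε3 : ε * (T * η) ≤ b := by
    have h1 : ε ≤ b / (T * η) := hε1.trans ((min_le_right _ _).trans (min_le_right _ _))
    rwa [le_div_iff₀ (by positivity)] at h1
  set κ₂ := 1 - ε * (T * η / 2) / b
  have hκ0 : 0 < κ₂ := by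
    have : ε * (T * η / 2) / b ≤ 1 / 2 := by
      rw [div_le_iff₀ hb]; linarith
    simp only [κ₂]; linarith
  have hκ1 : κ₂ < 1 := by
    have : 0 < ε * (T * η / 2) / b := by positivity
    simp only [κ₂]; linarith
  -- A factor 2 for each passage between `x` and `y`, and the condition number of the form `P`.
  set K := 4 * Real.sqrt (b / c)
  have hK : 0 < K := by positivity
  have hK2 : K ^ 2 = 16 * (b / c) := by
    rw [mul_pow, Real.sq_sqrt (by positivity)]; norm_num
  -- This radius keeps every `‖x k‖` below `ρ`, where the recursion is valid, and below `μ / 4`, so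
  -- that `‖y k‖ ≤ μ / 2`. The rate for the norm is the square root of the rate for the form.
  refine ⟨min ρ (μ / 4) / K, by positivity, K, hK, Real.sqrt κ₂, Real.sqrt_pos.2 hκ0,
    (Real.sqrt_lt' one_pos).2 (by simpa using hκ1), fun S x Q hS hQ0 hx0 hstep => ?_⟩
  set y : ℕ → ι → ℝ := fun k => x k - (ε * T) • S k *ᵥ x k
  have hSx : ∀ k, ‖(ε * T) • S k *ᵥ x k‖ ≤ ‖x k‖ / 2 := by
    intro k
    rw [norm_smul, Real.norm_eq_abs, abs_of_pos (by positivity)]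
    have h1 := mul_le_mul_of_nonneg_left (norm_mulVec_le_of_entrySum_le (hS k) (x k))
      (by positivity : 0 ≤ ε * T)
    have h2 := mul_le_mul_of_nonneg_right hεB (norm_nonneg (x k))
    linarith
  have hyx : ∀ k, ‖y k‖ ≤ 2 * ‖x k‖ := fun k => by
    have := norm_sub_le (x k) ((ε * T) • S k *ᵥ x k)
    linarith [hSx k, norm_nonneg (x k)]
  have hxy : ∀ k, ‖x k‖ ≤ 2 * ‖y k‖ := fun k => by
    have := norm_sub_norm_le (x k) ((ε * T) • S k *ᵥ x k)
    linarith [hSx k]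
  have hV : ∀ k, y k ⬝ᵥ P *ᵥ y k ≤ κ₂ ^ k * (y 0 ⬝ᵥ P *ᵥ y 0) →
      ‖x k‖ ≤ K * Real.sqrt κ₂ ^ k * ‖x 0‖ := by
    intro k hk
    refine le_of_sq_le_sq ?_ (by positivity)
    have h1 := hcP (y k)
    have h2 := hbP (y 0)
    have h3 : ‖y 0‖ ^ 2 ≤ (2 * ‖x 0‖) ^ 2 := by gcongr; exact hyx 0
    have h4 : ‖x k‖ ^ 2 ≤ (2 * ‖y k‖) ^ 2 := by gcongr; exact hxy k
    have h5 : c * ‖x k‖ ^ 2 ≤ c * (K * Real.sqrt κ₂ ^ k * ‖x 0‖) ^ 2 := by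
      calc c * ‖x k‖ ^ 2 ≤ c * (2 * ‖y k‖) ^ 2 := by gcongr
        _ = 4 * (c * ‖y k‖ ^ 2) := by ring
        _ ≤ 4 * (κ₂ ^ k * (b * (2 * ‖x 0‖) ^ 2)) := by
            refine mul_le_mul_of_nonneg_left (h1.trans (hk.trans ?_)) (by norm_num)
            exact mul_le_mul_of_nonneg_left (h2.trans (by gcongr)) (by positivity)
        _ = c * (K ^ 2 * (Real.sqrt κ₂ ^ 2) ^ k * ‖x 0‖ ^ 2) := by
            rw [hK2, Real.sq_sqrt hκ0.le]; field_simp; ring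
        _ = _ := by ring
    exact le_of_mul_le_mul_left h5 hc
  have hsmall : ∀ k, ‖x k‖ ≤ K * Real.sqrt κ₂ ^ k * ‖x 0‖ → ‖x k‖ ≤ min ρ (μ / 4) := by
    intro k hk
    refine hk.trans ?_
    have h1 : Real.sqrt κ₂ ^ k ≤ 1 :=
      pow_le_one₀ (Real.sqrt_nonneg _) (Real.sqrt_le_one.2 hκ1.le)
    calc K * Real.sqrt κ₂ ^ k * ‖x 0‖ ≤ K * 1 * (min ρ (μ / 4) / K) := by gcongr
      _ = _ := by field_simp
  -- Bootstrap: decay up to step `k` keeps `x k` small, which validates the next step of the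
  -- recursion.
  have main : ∀ k, Q k ∧ y k ⬝ᵥ P *ᵥ y k ≤ κ₂ ^ k * (y 0 ⬝ᵥ P *ᵥ y 0) := by
    intro k
    induction k with
    | zero => exact ⟨hQ0, by simp⟩
    | succ k ih =>
      have hxk := hsmall k (hV k ih.2)
      obtain ⟨hQ, hx⟩ := hstep k ih.1 (hxk.trans (min_le_left _ _))
      refine ⟨hQ, ?_⟩
      have h1 := norm_averaged_step_le hT hε (hS k) (hS (k + 1)) hεB hx
      have h2 : ‖y (k + 1) - y k - (ε * T) • A *ᵥ y k‖ ≤ D * ε * (ε * ‖y k‖ + ‖y k‖ ^ 2) := by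
        refine h1.trans ?_
        calc _ ≤ (T ^ 2 * (2 * a * B + 2 * B ^ 2) + 2 * C) * ε
              * (ε * (2 * ‖y k‖) + (2 * ‖y k‖) ^ 2) := by gcongr <;> exact hxy k
          _ ≤ (T ^ 2 * (2 * a * B + 2 * B ^ 2) + 2 * C) * ε
              * (4 * (ε * ‖y k‖ + ‖y k‖ ^ 2)) := by
              gcongr
              have : 0 ≤ ε * ‖y k‖ := by positivity
              linarith
          _ = _ := by simp only [D]; ring
      have h3 : ε + ‖y k‖ ≤ μ := by
        have := hyx k
        have := hxk.trans (min_le_right _ _)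
        linarith
      have h4 := quadForm_step_le hPs hA (show entrySum P ≤ b by simp [b]) hT hε hD hμ1 hμM h3 h2
      have h5 : ε * (T * η / 2) / b * (y k ⬝ᵥ P *ᵥ y k) ≤ ε * (T * η / 2) * ‖y k‖ ^ 2 := by
        calc _ ≤ ε * (T * η / 2) / b * (b * ‖y k‖ ^ 2) := by gcongr; exact hbP _
          _ = _ := by field_simp
      calc _ ≤ κ₂ * (y k ⬝ᵥ P *ᵥ y k) := by simp only [κ₂]; linarith
        _ ≤ κ₂ * (κ₂ ^ k * (y 0 ⬝ᵥ P *ᵥ y 0)) := by gcongr; exact ih.2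
        _ = _ := by ring
  intro k
  have hk := hV k (main k).2
  exact ⟨(main k).1, (hsmall k hk).trans (min_le_left _ _), hk⟩

end DiscreteAveraging

/-! ### Bounds for the spacecraft matrices near the target attitude. -/

theorem norm_skew_mulVec_le (a v : Fin 3 → ℝ) : ‖skew a *ᵥ v‖ ≤ 2 * ‖a‖ * ‖v‖ := by
  refine (pi_norm_le_iff_of_nonneg (by positivity)).2 fun i => ?_
  have ha : ∀ i, |a i| ≤ ‖a‖ := norm_le_pi_norm a
  have hv : ∀ i, |v i| ≤ ‖v‖ := norm_le_pi_norm v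
  have h : ∀ i j k l, |a i * v j + a k * v l| ≤ 2 * ‖a‖ * ‖v‖ := fun i j k l => by
    have h1 := mul_le_mul (ha i) (hv j) (abs_nonneg _) (norm_nonneg _)
    have h2 := mul_le_mul (ha k) (hv l) (abs_nonneg _) (norm_nonneg _)
    rw [← abs_mul] at h1 h2
    linarith [abs_add_le (a i * v j) (a k * v l)]
  have h' : ∀ i j k l, |a i * v j - a k * v l| ≤ 2 * ‖a‖ * ‖v‖ := fun i j k l => by
    have h1 := mul_le_mul (ha i) (hv j) (abs_nonneg _) (norm_nonneg _)
    have h2 := mul_le_mul (ha k) (hv l) (abs_nonneg _) (norm_nonneg _)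
    rw [← abs_mul] at h1 h2
    linarith [abs_sub (a i * v j) (a k * v l)]
  rw [Real.norm_eq_abs]
  fin_cases i
  · convert h' 1 2 2 1 using 2
    simp [skew, Matrix.mulVec, dotProduct, Fin.sum_univ_three]; ring
  · convert h' 2 0 0 2 using 2
    simp [skew, Matrix.mulVec, dotProduct, Fin.sum_univ_three]; ring
  · convert h' 0 1 1 0 using 2
    simp [skew, Matrix.mulVec, dotProduct, Fin.sum_univ_three]; ring

theorem transpose_skew (a : Fin 3 → ℝ) : (skew a)ᵀ = -skew a := by
  ext i j
  fin_cases i <;> fin_cases j <;> simp [skew]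

theorem skew_sub (a b : Fin 3 → ℝ) : skew (a - b) = skew a - skew b := by
  ext i j
  fin_cases i <;> fin_cases j <;> simp [skew] <;> ring

theorem norm_skew_transpose_mulVec_le (a v : Fin 3 → ℝ) : ‖(skew a)ᵀ *ᵥ v‖ ≤ 2 * ‖a‖ * ‖v‖ := by
  rw [transpose_skew, Matrix.neg_mulVec, norm_neg]
  exact norm_skew_mulVec_le a v

theorem qv_eq (q : Fin 4 → ℝ) : qv (q - qbar) = qv q := by
  ext i
  fin_cases i <;> simp [qv, qbar]

theorem norm_qv_le (q : Fin 4 → ℝ) : ‖qv q‖ ≤ ‖q - qbar‖ := by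
  rw [← qv_eq]
  refine (pi_norm_le_iff_of_nonneg (norm_nonneg _)).2 fun i => ?_
  fin_cases i
  · exact norm_le_pi_norm (q - qbar) 0
  · exact norm_le_pi_norm (q - qbar) 1
  · exact norm_le_pi_norm (q - qbar) 2

theorem abs_sub_one_le (q : Fin 4 → ℝ) : |q 3 - 1| ≤ ‖q - qbar‖ := by
  simpa [qbar] using norm_le_pi_norm (q - qbar) 3

theorem W_mulVec_eq (q : Fin 4 → ℝ) (w : Fin 3 → ℝ) :
    qv (W q *ᵥ w) = (1 / 2 : ℝ) • (q 3 • w + skew (qv q) *ᵥ w) := by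
  ext i
  fin_cases i <;>
    simp [qv, W, skew, Matrix.mulVec, dotProduct, Fin.sum_univ_three, Matrix.vecHead,
      Matrix.vecTail] <;> ring

theorem norm_W_mulVec_le {q : Fin 4 → ℝ} {w : Fin 3 → ℝ} (hq : ‖q - qbar‖ ≤ 2) :
    ‖W q *ᵥ w‖ ≤ 5 * ‖w‖ := by
  have hqi : ∀ i, |q i| ≤ 3 := by
    intro i
    have h1 : |q i - qbar i| ≤ 2 := (norm_le_pi_norm (q - qbar) i).trans hq
    have h2 : |qbar i| ≤ 1 := by fin_cases i <;> simp [qbar]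
    have := abs_add_le (q i - qbar i) (qbar i)
    rw [sub_add_cancel] at this
    linarith
  have hw : ∀ i, |w i| ≤ ‖w‖ := norm_le_pi_norm w
  have hm : ∀ i j, |q i * w j| ≤ 3 * ‖w‖ := fun i j => by
    rw [abs_mul]
    exact mul_le_mul (hqi i) (hw j) (abs_nonneg _) (by norm_num)
  refine (pi_norm_le_iff_of_nonneg (by positivity)).2 fun i => ?_
  rw [Real.norm_eq_abs]
  have hn := norm_nonneg w
  fin_cases i <;>
    simp only [W, Matrix.mulVec, dotProduct, Fin.sum_univ_three, Matrix.smul_apply, smul_eq_mul,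
      Matrix.of_apply, Matrix.cons_val, Matrix.cons_val_zero, Matrix.cons_val_one,
      Fin.zero_eta, Fin.mk_one, Fin.reduceFinMk, Fin.isValue] <;>
    rw [abs_le]
  · have h1 := abs_le.1 (hm 3 0); have h2 := abs_le.1 (hm 2 1); have h3 := abs_le.1 (hm 1 2)
    constructor <;> linarith
  · have h1 := abs_le.1 (hm 2 0); have h2 := abs_le.1 (hm 3 1); have h3 := abs_le.1 (hm 0 2)
    constructor <;> linarith
  · have h1 := abs_le.1 (hm 1 0); have h2 := abs_le.1 (hm 0 1); have h3 := abs_le.1 (hm 3 2)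
    constructor <;> linarith
  · have h1 := abs_le.1 (hm 0 0); have h2 := abs_le.1 (hm 1 1); have h3 := abs_le.1 (hm 2 2)
    constructor <;> linarith

theorem attitude_mulVec_eq (q : Fin 4 → ℝ) (b : Fin 3 → ℝ) :
    attitude q *ᵥ b = ((q 3) ^ 2 - qv q ⬝ᵥ qv q) • b + (2 * (qv q ⬝ᵥ b)) • qv q
      - (2 * q 3) • skew (qv q) *ᵥ b := by
  rw [attitude, Matrix.sub_mulVec, Matrix.add_mulVec, Matrix.smul_mulVec, Matrix.smul_mulVec,
    Matrix.smul_mulVec, Matrix.one_mulVec, Matrix.vecMulVec_mulVec]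
  simp [smul_smul]

theorem abs_dotProduct_le_three (u v : Fin 3 → ℝ) : |u ⬝ᵥ v| ≤ 3 * ‖u‖ * ‖v‖ := by
  rw [dotProduct]
  refine (Finset.abs_sum_le_sum_abs _ _).trans ?_
  refine (Finset.sum_le_card_nsmul _ _ (‖u‖ * ‖v‖) fun i _ => ?_).trans (by simp [mul_assoc])
  rw [abs_mul]
  exact mul_le_mul (norm_le_pi_norm u i) (norm_le_pi_norm v i) (abs_nonneg _) (norm_nonneg _)

/-- Every term of `C(q) b - b` has a factor `q_4 - 1` or `q_v`. Unit length of `q` is not assumed,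
so the bound is available on a full ball of the ambient space. -/
theorem norm_attitude_mulVec_sub_le {q : Fin 4 → ℝ} (hq : ‖q - qbar‖ ≤ 2) (b : Fin 3 → ℝ) :
    ‖attitude q *ᵥ b - b‖ ≤ 40 * ‖q - qbar‖ * ‖b‖ := by
  set e := ‖q - qbar‖
  have he : 0 ≤ e := norm_nonneg _
  have hv := norm_qv_le q
  have h3 := abs_sub_one_le q
  have h3' : |q 3 + 1| ≤ 4 := by rw [abs_le] at h3 ⊢; constructor <;> linarith
  have h3'' : |q 3| ≤ 3 := by rw [abs_le] at h3 ⊢; constructor <;> linarith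
  have e1 : attitude q *ᵥ b - b = ((q 3 - 1) * (q 3 + 1) - qv q ⬝ᵥ qv q) • b
      + (2 * (qv q ⬝ᵥ b)) • qv q - (2 * q 3) • skew (qv q) *ᵥ b := by
    rw [attitude_mulVec_eq]; module
  rw [e1]
  have n1 : ‖((q 3 - 1) * (q 3 + 1) - qv q ⬝ᵥ qv q) • b‖ ≤ (10 * e) * ‖b‖ := by
    rw [norm_smul]
    refine mul_le_mul_of_nonneg_right ?_ (norm_nonneg _)
    refine (norm_sub_le _ _).trans ?_
    rw [norm_mul]
    have h1 : ‖q 3 - 1‖ * ‖q 3 + 1‖ ≤ e * 4 := mul_le_mul h3 h3' (norm_nonneg _) he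
    have h2 := abs_dotProduct_le_three (qv q) (qv q)
    have h4 : 3 * ‖qv q‖ * ‖qv q‖ ≤ 3 * e * 2 := by gcongr; exact hv.trans hq
    rw [← Real.norm_eq_abs] at h2
    linarith
  have n2 : ‖(2 * (qv q ⬝ᵥ b)) • qv q‖ ≤ (12 * e) * ‖b‖ := by
    rw [norm_smul, norm_mul, Real.norm_two, Real.norm_eq_abs]
    calc 2 * |qv q ⬝ᵥ b| * ‖qv q‖ ≤ 2 * (3 * e * ‖b‖) * 2 := by
          gcongr
          · exact (abs_dotProduct_le_three _ _).trans (by gcongr)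
          · exact hv.trans hq
      _ = _ := by ring
  have n3 : ‖(2 * q 3) • skew (qv q) *ᵥ b‖ ≤ (12 * e) * ‖b‖ := by
    rw [norm_smul, norm_mul, Real.norm_two, Real.norm_eq_abs]
    calc 2 * |q 3| * ‖skew (qv q) *ᵥ b‖ ≤ 2 * 3 * (2 * e * ‖b‖) := by
          gcongr
          exact (norm_skew_mulVec_le _ _).trans (by gcongr)
      _ = _ := by ring
  have h5 := norm_sub_le (((q 3 - 1) * (q 3 + 1) - qv q ⬝ᵥ qv q) • b + (2 * (qv q ⬝ᵥ b)) • qv q)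
    ((2 * q 3) • skew (qv q) *ᵥ b)
  have h6 := norm_add_le (((q 3 - 1) * (q 3 + 1) - qv q ⬝ᵥ qv q) • b) ((2 * (qv q ⬝ᵥ b)) • qv q)
  have h7 : 0 ≤ e * ‖b‖ := by positivity
  linarith

theorem norm_attitude_mulVec_le {q : Fin 4 → ℝ} (hq : ‖q - qbar‖ ≤ 2) (b : Fin 3 → ℝ) :
    ‖attitude q *ᵥ b‖ ≤ 81 * ‖b‖ := by
  have h1 := norm_attitude_mulVec_sub_le hq b
  have h2 := norm_sub_norm_le (attitude q *ᵥ b) b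
  have h3 : 40 * ‖q - qbar‖ * ‖b‖ ≤ 40 * 2 * ‖b‖ := by gcongr
  linarith

theorem Orbit.exists_norm_Bi_le (o : Orbit) (hR : o.R ≠ 0) : ∃ β ≥ 0, ∀ t, ‖o.Bi t‖ ≤ β := by
  obtain ⟨a, b, c, h⟩ := o.exists_Bi_eq hR
  refine ⟨‖a‖ + ‖b‖ + ‖c‖, by positivity, fun t => ?_⟩
  rw [h]
  refine (norm_add₃_le).trans ?_
  rw [norm_smul, norm_smul]
  have h1 := mul_le_mul_of_nonneg_right (Real.abs_cos_le_one (2 * (o.n * t + o.φ₀))) (norm_nonneg b)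
  have h2 := mul_le_mul_of_nonneg_right (Real.abs_sin_le_one (2 * (o.n * t + o.φ₀))) (norm_nonneg c)
  simp only [Real.norm_eq_abs]
  linarith

/-! ### The scaled equations of motion and their linearization. -/

/-- States `(q, w)`, where the angular velocity is `ω = ε w`. -/
abbrev State := (Fin 4 → ℝ) × (Fin 3 → ℝ)

/-- The equilibrium `(qbar, 0)`. -/
def zbar : State := (qbar, 0)

/-- The held magnetic dipole moment, divided by `ε ^ 2`, in terms of the scaled state. -/
def Orbit.dipole (o : Orbit) (k₁ k₂ : ℝ) (z : State) (t : ℝ) : Fin 3 → ℝ :=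
  (skew (attitude z.1 *ᵥ o.Bi t))ᵀ *ᵥ (k₁ • qv z.1 + k₂ • z.2)

/-- The total torque, divided by `ε ^ 2`, in terms of the scaled state, where `b` is the
geomagnetic field in inertial coordinates and `m` the scaled dipole moment. -/
def torque (J : Matrix (Fin 3) (Fin 3) ℝ) (b m : Fin 3 → ℝ) (z : State) : Fin 3 → ℝ :=
  -(skew z.2 *ᵥ (J *ᵥ z.2)) - skew (attitude z.1 *ᵥ b) *ᵥ m

/-- The right-hand side of the equations of motion of the scaled state, divided by `ε`. -/
def scaledField (J : Matrix (Fin 3) (Fin 3) ℝ) (b m : Fin 3 → ℝ) (z : State) : State :=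
  (W z.1 *ᵥ z.2, J⁻¹ *ᵥ torque J b m z)

theorem norm_fst_sub_le (z : State) : ‖z.1 - qbar‖ ≤ ‖z - zbar‖ := norm_fst_le (z - zbar)

theorem norm_snd_le' (z : State) : ‖z.2‖ ≤ ‖z - zbar‖ := by
  simpa [zbar] using norm_snd_le (z - zbar)

theorem norm_control_le {k₁ k₂ : ℝ} (hk₁ : 0 ≤ k₁) (hk₂ : 0 ≤ k₂) (z : State) :
    ‖k₁ • qv z.1 + k₂ • z.2‖ ≤ (k₁ + k₂) * ‖z - zbar‖ := by
  refine (norm_add_le _ _).trans ?_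
  rw [norm_smul, norm_smul, Real.norm_of_nonneg hk₁, Real.norm_of_nonneg hk₂, add_mul]
  gcongr
  · exact (norm_qv_le z.1).trans (norm_fst_sub_le z)
  · exact norm_snd_le' z

theorem Orbit.norm_dipole_le (o : Orbit) {k₁ k₂ β r : ℝ} (hk₁ : 0 ≤ k₁) (hk₂ : 0 ≤ k₂)
    (hβ : ∀ t, ‖o.Bi t‖ ≤ β) {z : State} (hz : ‖z - zbar‖ ≤ r) (hr : r ≤ 2) (t : ℝ) :
    ‖o.dipole k₁ k₂ z t‖ ≤ 162 * β * (k₁ + k₂) * r := by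
  have hβ0 : 0 ≤ β := (norm_nonneg _).trans (hβ 0)
  have hr0 : 0 ≤ r := (norm_nonneg _).trans hz
  have h1 := norm_attitude_mulVec_le ((norm_fst_sub_le z).trans (hz.trans hr)) (o.Bi t)
  calc _ ≤ 2 * (81 * β) * ((k₁ + k₂) * r) := by
        refine (norm_skew_transpose_mulVec_le _ _).trans ?_
        gcongr
        · exact h1.trans (by gcongr; exact hβ t)
        · exact (norm_control_le hk₁ hk₂ z).trans (by gcongr)
    _ = _ := by ring

theorem norm_gyroscopic_le (J : Matrix (Fin 3) (Fin 3) ℝ) {r : ℝ} {w : Fin 3 → ℝ}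
    (hw : ‖w‖ ≤ 2 * r) : ‖skew w *ᵥ (J *ᵥ w)‖ ≤ 8 * entrySum J * r ^ 2 := by
  have hr : 0 ≤ 2 * r := (norm_nonneg _).trans hw
  have hJ := entrySum_nonneg J
  calc _ ≤ 2 * (2 * r) * (entrySum J * (2 * r)) := by
        refine (norm_skew_mulVec_le _ _).trans ?_
        gcongr
        exact (norm_mulVec_le_entrySum J w).trans (by gcongr)
    _ = _ := by ring

/-- The held dipole is `O(r)` and the gyroscopic term `O(r²)`. The running state is allowed the
radius `2 r` because the error may double within a sampling interval. -/
theorem exists_norm_scaledField_le (o : Orbit) (hR : o.R ≠ 0) (J : Matrix (Fin 3) (Fin 3) ℝ)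
    {k₁ k₂ : ℝ} (hk₁ : 0 ≤ k₁) (hk₂ : 0 ≤ k₂) :
    ∃ M > 0, ∀ (r : ℝ) (z z₀ : State) (t t₀ : ℝ), r ≤ 1 → ‖z₀ - zbar‖ ≤ r → ‖z - zbar‖ ≤ 2 * r →
      ‖scaledField J (o.Bi t) (o.dipole k₁ k₂ z₀ t₀) z‖ ≤ M * r := by
  obtain ⟨β, hβ0, hβ⟩ := o.exists_norm_Bi_le hR
  have hJ := entrySum_nonneg J
  have hJi := entrySum_nonneg J⁻¹
  set N := 8 * entrySum J + 162 * β * (162 * β * (k₁ + k₂))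
  have hN : 0 ≤ N := by positivity
  refine ⟨10 + entrySum J⁻¹ * N, by positivity, fun r z z₀ t t₀ hr hz₀ hz => ?_⟩
  have hr0 : 0 ≤ r := (norm_nonneg _).trans hz₀
  have hw : ‖z.2‖ ≤ 2 * r := (norm_snd_le' z).trans hz
  have hq : ‖z.1 - qbar‖ ≤ 2 := (norm_fst_sub_le z).trans (hz.trans (by linarith))
  have h1 : ‖W z.1 *ᵥ z.2‖ ≤ 10 * r := (norm_W_mulVec_le hq).trans (by linarith)
  have h2 : ‖torque J (o.Bi t) (o.dipole k₁ k₂ z₀ t₀) z‖ ≤ N * r := by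
    refine (norm_sub_le _ _).trans ?_
    rw [norm_neg]
    have g1 := norm_gyroscopic_le J hw
    have g2 : 8 * entrySum J * r ^ 2 ≤ 8 * entrySum J * r := by
      gcongr; nlinarith
    have g3 : ‖skew (attitude z.1 *ᵥ o.Bi t) *ᵥ o.dipole k₁ k₂ z₀ t₀‖
        ≤ 2 * (81 * β) * (162 * β * (k₁ + k₂) * r) := by
      refine (norm_skew_mulVec_le _ _).trans ?_
      gcongr
      · exact (norm_attitude_mulVec_le hq _).trans (by gcongr; exact hβ t)
      · exact o.norm_dipole_le hk₁ hk₂ hβ hz₀ (by linarith) t₀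
    simp only [N]
    linarith
  have h3 : ‖J⁻¹ *ᵥ torque J (o.Bi t) (o.dipole k₁ k₂ z₀ t₀) z‖ ≤ entrySum J⁻¹ * (N * r) :=
    (norm_mulVec_le_entrySum _ _).trans (by gcongr)
  have h4 : 0 ≤ entrySum J⁻¹ * (N * r) := by positivity
  refine max_le (h1.trans ?_) (h3.trans ?_) <;> nlinarith

/-- The vector part of the attitude error and the scaled angular velocity. -/
def reduced (z : State) : Fin 3 ⊕ Fin 3 → ℝ := Sum.elim (qv z.1) z.2

/-- The linearization of `scaledField` with the held state `z₀`, in the coordinates `reduced`. -/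
def Orbit.linearField (o : Orbit) (J : Matrix (Fin 3) (Fin 3) ℝ) (k₁ k₂ : ℝ) (z₀ : State)
    (t₀ t : ℝ) : Fin 3 ⊕ Fin 3 → ℝ :=
  Sum.elim ((1 / 2 : ℝ) • z₀.2)
    (-(J⁻¹ *ᵥ (skew (o.Bi t) *ᵥ ((skew (o.Bi t₀))ᵀ *ᵥ (k₁ • qv z₀.1 + k₂ • z₀.2)))))

/-- Freezing `w` in the kinematics costs `‖z - z₀‖`; all other errors are products of two quantities
of order `r`. -/
theorem exists_norm_reduced_sub_linearField_le (o : Orbit) (hR : o.R ≠ 0)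
    (J : Matrix (Fin 3) (Fin 3) ℝ) {k₁ k₂ : ℝ} (hk₁ : 0 ≤ k₁) (hk₂ : 0 ≤ k₂) :
    ∃ N > 0, ∀ (r : ℝ) (z z₀ : State) (t t₀ : ℝ), r ≤ 1 → ‖z₀ - zbar‖ ≤ r → ‖z - zbar‖ ≤ 2 * r →
      ‖reduced (scaledField J (o.Bi t) (o.dipole k₁ k₂ z₀ t₀) z)
        - o.linearField J k₁ k₂ z₀ t₀ t‖ ≤ N * (‖z - z₀‖ + r ^ 2) := by
  obtain ⟨β, hβ0, hβ⟩ := o.exists_norm_Bi_le hR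
  have hJ := entrySum_nonneg J
  have hJi := entrySum_nonneg J⁻¹
  set N := 8 * entrySum J + 160 * β * (162 * β * (k₁ + k₂)) + 2 * β * (80 * β * (k₁ + k₂))
  have hN : 0 ≤ N := by positivity
  refine ⟨8 + entrySum J⁻¹ * N, by positivity, fun r z z₀ t t₀ hr hz₀ hz => ?_⟩
  have hr0 : 0 ≤ r := (norm_nonneg _).trans hz₀
  have hw : ‖z.2‖ ≤ 2 * r := (norm_snd_le' z).trans hz
  have hq' : ‖z.1 - qbar‖ ≤ 2 * r := (norm_fst_sub_le z).trans hz
  have hq : ‖z.1 - qbar‖ ≤ 2 := hq'.trans (by linarith)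
  have hq₀ : ‖z₀.1 - qbar‖ ≤ r := (norm_fst_sub_le z₀).trans hz₀
  set v := k₁ • qv z₀.1 + k₂ • z₀.2
  have hv : ‖v‖ ≤ (k₁ + k₂) * r := (norm_control_le hk₁ hk₂ z₀).trans (by gcongr)
  have h1 : ‖qv (W z.1 *ᵥ z.2) - (1 / 2 : ℝ) • z₀.2‖ ≤ ‖z - z₀‖ + 8 * r ^ 2 := by
    rw [W_mulVec_eq, show (1 / 2 : ℝ) • (z.1 3 • z.2 + skew (qv z.1) *ᵥ z.2) - (1 / 2 : ℝ) • z₀.2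
      = (1 / 2 : ℝ) • ((z.2 - z₀.2) + (z.1 3 - 1) • z.2 + skew (qv z.1) *ᵥ z.2) by module,
      norm_smul]
    have g1 : ‖z.2 - z₀.2‖ ≤ ‖z - z₀‖ := norm_snd_le (z - z₀)
    have g2 : ‖(z.1 3 - 1) • z.2‖ ≤ (2 * r) * (2 * r) := by
      rw [norm_smul]
      have := (abs_sub_one_le z.1).trans hq'
      gcongr
      exact this
    have g3 : ‖skew (qv z.1) *ᵥ z.2‖ ≤ 2 * (2 * r) * (2 * r) := by
      refine (norm_skew_mulVec_le _ _).trans ?_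
      gcongr
      exact (norm_qv_le _).trans hq'
    have g4 := norm_add₃_le (a := z.2 - z₀.2) (b := (z.1 3 - 1) • z.2) (c := skew (qv z.1) *ᵥ z.2)
    rw [Real.norm_of_nonneg (by norm_num : (0 : ℝ) ≤ 1 / 2)]
    nlinarith [norm_nonneg (z - z₀)]
  have h2 : ‖torque J (o.Bi t) (o.dipole k₁ k₂ z₀ t₀) z
      + skew (o.Bi t) *ᵥ ((skew (o.Bi t₀))ᵀ *ᵥ v)‖ ≤ N * r ^ 2 := by
    -- The torque error splits into the gyroscopic term, the attitude error at time `t`, and the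
    -- attitude error inside the sampled dipole.
    have e : torque J (o.Bi t) (o.dipole k₁ k₂ z₀ t₀) z
        + skew (o.Bi t) *ᵥ ((skew (o.Bi t₀))ᵀ *ᵥ v)
        = -(skew z.2 *ᵥ (J *ᵥ z.2))
          + -(skew (attitude z.1 *ᵥ o.Bi t - o.Bi t) *ᵥ o.dipole k₁ k₂ z₀ t₀)
          + -(skew (o.Bi t) *ᵥ ((skew (attitude z₀.1 *ᵥ o.Bi t₀ - o.Bi t₀))ᵀ *ᵥ v)) := by
      simp only [torque, Orbit.dipole, v, skew_sub, Matrix.transpose_sub, Matrix.sub_mulVec,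
        Matrix.mulVec_sub]
      abel
    rw [e]
    refine norm_add₃_le.trans ?_
    rw [norm_neg, norm_neg, norm_neg]
    have g1 := norm_gyroscopic_le J hw
    have g2 : ‖skew (attitude z.1 *ᵥ o.Bi t - o.Bi t) *ᵥ o.dipole k₁ k₂ z₀ t₀‖
        ≤ 2 * (40 * (2 * r) * β) * (162 * β * (k₁ + k₂) * r) := by
      refine (norm_skew_mulVec_le _ _).trans ?_
      gcongr
      · exact (norm_attitude_mulVec_sub_le hq _).trans (by gcongr; exact hβ t)
      · exact o.norm_dipole_le hk₁ hk₂ hβ hz₀ (by linarith) t₀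
    have g3 : ‖skew (o.Bi t) *ᵥ ((skew (attitude z₀.1 *ᵥ o.Bi t₀ - o.Bi t₀))ᵀ *ᵥ v)‖
        ≤ 2 * β * (2 * (40 * r * β) * ((k₁ + k₂) * r)) := by
      refine (norm_skew_mulVec_le _ _).trans ?_
      gcongr
      · exact hβ t
      · refine (norm_skew_transpose_mulVec_le _ _).trans ?_
        gcongr
        exact (norm_attitude_mulVec_sub_le (hq₀.trans (by linarith)) _).trans
          (by gcongr; exact hβ t₀)
    simp only [N]
    linarith
  have h3 : ‖J⁻¹ *ᵥ (torque J (o.Bi t) (o.dipole k₁ k₂ z₀ t₀) z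
      + skew (o.Bi t) *ᵥ ((skew (o.Bi t₀))ᵀ *ᵥ v))‖ ≤ entrySum J⁻¹ * (N * r ^ 2) :=
    (norm_mulVec_le_entrySum _ _).trans (by gcongr)
  have e : reduced (scaledField J (o.Bi t) (o.dipole k₁ k₂ z₀ t₀) z)
        - o.linearField J k₁ k₂ z₀ t₀ t = Sum.elim (qv (W z.1 *ᵥ z.2) - (1 / 2 : ℝ) • z₀.2)
        (J⁻¹ *ᵥ (torque J (o.Bi t) (o.dipole k₁ k₂ z₀ t₀) z
      + skew (o.Bi t) *ᵥ ((skew (o.Bi t₀))ᵀ *ᵥ v))) := by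
    rw [Matrix.mulVec_add]
    ext (i | i) <;> simp [reduced, scaledField, Orbit.linearField, v]
  rw [e, norm_sumElim]
  have h4 : 0 ≤ entrySum J⁻¹ * N := by positivity
  have h5 := norm_nonneg (z - z₀)
  refine max_le (h1.trans ?_) (h3.trans ?_) <;> nlinarith [mul_nonneg h4 h5, mul_nonneg h4 (sq_nonneg r)]

/-! ### Motion over one sampling interval. -/

/-- `z` solves the scaled equations of motion on `[a, b]`, with the dipole moment computed at
time `a`. -/
def IsArc (o : Orbit) (J : Matrix (Fin 3) (Fin 3) ℝ) (k₁ k₂ ε a b : ℝ) (z : ℝ → State) : Prop :=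
  ∀ t ∈ Icc a b, HasDerivWithinAt z
    (ε • scaledField J (o.Bi t) (o.dipole k₁ k₂ (z a) a) (z t)) (Icc a b) t

theorem HasDerivWithinAt.mulVec_const {m n : Type*} [Fintype m] [Fintype n]
    {M : ℝ → Matrix m n ℝ} {M' : Matrix m n ℝ} {s : Set ℝ} {t : ℝ}
    (h : ∀ i j, HasDerivWithinAt (fun t => M t i j) (M' i j) s t) (v : n → ℝ) :
    HasDerivWithinAt (fun t => M t *ᵥ v) (M' *ᵥ v) s t :=
  hasDerivWithinAt_pi.2 fun i => HasDerivWithinAt.fun_sum fun j _ => (h i j).mul_const (v j)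

theorem HasDerivWithinAt.const_mulVec {m n : Type*} [Fintype m] [Fintype n]
    (M : Matrix m n ℝ) {f : ℝ → n → ℝ} {f' : n → ℝ} {s : Set ℝ} {t : ℝ}
    (h : HasDerivWithinAt f f' s t) : HasDerivWithinAt (fun t => M *ᵥ f t) (M *ᵥ f') s t :=
  hasDerivWithinAt_pi.2 fun i => HasDerivWithinAt.fun_sum fun j _ =>
    (hasDerivWithinAt_pi.1 h j).const_mul (M i j)

/-- `reduced` as a linear map. -/
def reducedₗ : State →ₗ[ℝ] (Fin 3 ⊕ Fin 3 → ℝ) where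
  toFun := reduced
  map_add' x y := by
    ext (i | i)
    · fin_cases i <;> simp [reduced, qv]
    · simp [reduced]
  map_smul' c x := by
    ext (i | i)
    · fin_cases i <;> simp [reduced, qv]
    · simp [reduced]

theorem norm_reduced_le (z : State) : ‖reduced z‖ ≤ ‖z - zbar‖ := by
  rw [reduced, norm_sumElim]
  exact max_le ((norm_qv_le _).trans (norm_fst_sub_le z)) (norm_snd_le' z)

section Arc

variable {o : Orbit} {J : Matrix (Fin 3) (Fin 3) ℝ} {k₁ k₂ ε a b T M : ℝ} {z : ℝ → State}

theorem IsArc.continuousOn (hz : IsArc o J k₁ k₂ ε a b z) : ContinuousOn z (Icc a b) :=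
  fun t ht => (hz t ht).continuousWithinAt

theorem IsArc.norm_sub_zbar_le (hz : IsArc o J k₁ k₂ ε a b z) (hT : 0 < T) (hb : b = a + T)
    (hε : 0 < ε) (hεM : ε * M * T ≤ 1 / 2)
    (hM : ∀ (r : ℝ) (z z₀ : State) (t t₀ : ℝ), r ≤ 1 → ‖z₀ - zbar‖ ≤ r → ‖z - zbar‖ ≤ 2 * r →
      ‖scaledField J (o.Bi t) (o.dipole k₁ k₂ z₀ t₀) z‖ ≤ M * r)
    (ha : ‖z a - zbar‖ ≤ 1 / 2) : ∀ t ∈ Icc a b, ‖z t - zbar‖ ≤ 2 * ‖z a - zbar‖ := by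
  -- Comparison with the barrier `r (1 + (t - a)/T)`: on contact the speed is at most `ε M r ≤
  -- r/(2T)`, less than the slope `r/T`. Taking `r` strictly larger than the initial error gives
  -- strictness even when the arc starts at the equilibrium; `r` is then decreased to the initial
  -- error.
  have key : ∀ r, ‖z a - zbar‖ < r → r ≤ 1 → ∀ t ∈ Icc a b, ‖z t - zbar‖ ≤ 2 * r := by
    intro r har hr1 t ht
    have hr : 0 < r := (norm_nonneg _).trans_lt har
    have hB : ∀ t, HasDerivAt (fun t => r * (1 + (t - a) / T)) (r / T) t := fun t => by
      have := ((((hasDerivAt_id t).sub_const a).div_const T).const_add 1).const_mul r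
      exact this.congr_deriv (by field_simp)
    have hle : ∀ t ∈ Icc a b, (t - a) / T ≤ 1 := fun t ht => by
      rw [div_le_one hT]; linarith [ht.2]
    have h := image_norm_le_of_norm_deriv_right_lt_deriv_boundary'
      (f := fun t => z t - zbar) (B := fun t => r * (1 + (t - a) / T)) (B' := fun _ => r / T)
      (f' := fun t => ε • scaledField J (o.Bi t) (o.dipole k₁ k₂ (z a) a) (z t))
      (hz.continuousOn.sub continuousOn_const)
      (fun t ht => ((hz t (Ico_subset_Icc_self ht)).mono_of_mem_nhdsWithin
        (Icc_mem_nhdsGE_of_mem ht)).sub_const zbar)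
      (by simpa using har.le) (fun t _ => (hB t).continuousAt.continuousWithinAt)
      (fun t _ => (hB t).hasDerivWithinAt) (fun t ht hzt => by
        have h1 : ‖z t - zbar‖ ≤ 2 * r := by
          rw [hzt]
          nlinarith [hle t (Ico_subset_Icc_self ht)]
        rw [norm_smul, Real.norm_of_nonneg hε.le, lt_div_iff₀ hT]
        have h2 := mul_le_mul_of_nonneg_left (hM r (z t) (z a) t a hr1 har.le h1)
          (by positivity : 0 ≤ ε * T)
        have h3 := mul_le_mul_of_nonneg_right hεM hr.le
        linarith) ht
    refine h.trans ?_
    nlinarith [hle t ht]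
  intro t ht
  refine le_of_forall_gt_imp_ge_of_dense fun c hc => ?_
  have h1 := key (min (c / 2) 1) (lt_min (by linarith) (by linarith)) (min_le_right _ _) t ht
  exact h1.trans (by linarith [min_le_left (c / 2) 1])

theorem IsArc.norm_sub_le (hz : IsArc o J k₁ k₂ ε a b z) (hT : 0 < T) (hb : b = a + T)
    (hM0 : 0 < M) (hε : 0 < ε) (hεM : ε * M * T ≤ 1 / 2)
    (hM : ∀ (r : ℝ) (z z₀ : State) (t t₀ : ℝ), r ≤ 1 → ‖z₀ - zbar‖ ≤ r → ‖z - zbar‖ ≤ 2 * r →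
      ‖scaledField J (o.Bi t) (o.dipole k₁ k₂ z₀ t₀) z‖ ≤ M * r)
    (ha : ‖z a - zbar‖ ≤ 1 / 2) :
    ∀ t ∈ Icc a b, ‖z t - z a‖ ≤ ε * (M * T) * ‖z a - zbar‖ := by
  have hgr := hz.norm_sub_zbar_le hT hb hε hεM hM ha
  intro t ht
  have h := norm_image_sub_le_of_norm_deriv_le_segment' hz
    (C := ε * (M * ‖z a - zbar‖)) (fun t ht => by
      rw [norm_smul, Real.norm_of_nonneg hε.le]
      exact mul_le_mul_of_nonneg_left (hM _ (z t) (z a) t a (by linarith) le_rfl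
        (hgr t (Ico_subset_Icc_self ht))) hε.le) t ht
  refine h.trans ?_
  calc _ ≤ ε * (M * ‖z a - zbar‖) * T := by gcongr; linarith [ht.2]
    _ = _ := by ring

theorem Orbit.continuous_skew_Bi (o : Orbit) (hR : o.R ≠ 0) (i j : Fin 3) :
    Continuous fun t => skew (o.Bi t) i j := by
  obtain ⟨a, b, c, h⟩ := o.exists_skew_Bi_eq hR
  simp only [h]
  fun_prop

/-- The integral of the frozen linear field over the interval is exactly `T` times `averagedMatrix`
of `L(k,T)` applied to the sampled state, which is where `L` comes from. The mean value inequality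
for the difference with this primitive gives the remainder, the drift `‖z - z a‖` being `O(ε)` times
the initial error. -/
theorem IsArc.norm_reduced_step_le (hR : o.R ≠ 0) (hn : o.n ≠ 0) {k : ℤ}
    (hz : IsArc o J k₁ k₂ ε a b z) (hT : 0 < T) (hak : a = k * T) (hb : b = a + T)
    (hM0 : 0 < M) (hε : 0 < ε) (hεM : ε * M * T ≤ 1 / 2)
    (hM : ∀ (r : ℝ) (z z₀ : State) (t t₀ : ℝ), r ≤ 1 → ‖z₀ - zbar‖ ≤ r → ‖z - zbar‖ ≤ 2 * r →
      ‖scaledField J (o.Bi t) (o.dipole k₁ k₂ z₀ t₀) z‖ ≤ M * r) {N : ℝ} (hN0 : 0 < N)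
    (hN : ∀ (r : ℝ) (z z₀ : State) (t t₀ : ℝ), r ≤ 1 → ‖z₀ - zbar‖ ≤ r → ‖z - zbar‖ ≤ 2 * r →
      ‖reduced (scaledField J (o.Bi t) (o.dipole k₁ k₂ z₀ t₀) z)
        - o.linearField J k₁ k₂ z₀ t₀ t‖ ≤ N * (‖z - z₀‖ + r ^ 2))
    (ha : ‖z a - zbar‖ ≤ 1 / 2) :
    ‖reduced (z b) - reduced (z a)
        - (ε * T) • averagedMatrix J k₁ k₂ (o.L k T) *ᵥ reduced (z a)‖
      ≤ N * (M * T + 1) * T * ε * (ε * ‖z a - zbar‖ + ‖z a - zbar‖ ^ 2) := by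
  have hab : a ≤ b := by linarith
  have hgr := hz.norm_sub_zbar_le hT hb hε hεM hM ha
  have hdisp := hz.norm_sub_le hT hb hM0 hε hεM hM ha
  set r := ‖z a - zbar‖
  have hr : 0 ≤ r := norm_nonneg _
  set v := k₁ • qv (z a).1 + k₂ • (z a).2
  let I : ℝ → Matrix (Fin 3) (Fin 3) ℝ := fun t => Matrix.of fun i j =>
    ∫ τ in a..t, skew (o.Bi τ) i j
  have hI : ∀ t i j, HasDerivAt (fun t => I t i j) (skew (o.Bi t) i j) t := fun t i j =>
    intervalIntegral.integral_hasDerivAt_right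
      ((o.continuous_skew_Bi hR i j).intervalIntegrable _ _)
      ((o.continuous_skew_Bi hR i j).stronglyMeasurableAtFilter _ _)
      (o.continuous_skew_Bi hR i j).continuousAt
  -- The primitive of `linearField` that vanishes at `a`.
  let Ψ : ℝ → Fin 3 ⊕ Fin 3 → ℝ := fun t => Sum.elim ((t - a) • (1 / 2 : ℝ) • (z a).2)
    (-(J⁻¹ *ᵥ (I t *ᵥ ((skew (o.Bi a))ᵀ *ᵥ v))))
  have hΨ : ∀ t ∈ Icc a b, HasDerivWithinAt Ψ (o.linearField J k₁ k₂ (z a) a t) (Icc a b) t := by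
    intro t _
    have h1 : HasDerivWithinAt (fun t => (t - a) • (1 / 2 : ℝ) • (z a).2) ((1 / 2 : ℝ) • (z a).2)
        (Icc a b) t := by
      simpa using (((hasDerivAt_id t).sub_const a).smul_const
        ((1 / 2 : ℝ) • (z a).2)).hasDerivWithinAt
    have h2 := (HasDerivWithinAt.const_mulVec J⁻¹ (HasDerivWithinAt.mulVec_const
      (fun i j => (hI t i j).hasDerivWithinAt (s := Icc a b)) ((skew (o.Bi a))ᵀ *ᵥ v))).neg
    refine hasDerivWithinAt_pi.2 ?_
    rintro (i | i)
    · exact hasDerivWithinAt_pi.1 h1 i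
    · exact hasDerivWithinAt_pi.1 h2 i
  have hred : ∀ t ∈ Icc a b, HasDerivWithinAt (fun t => reduced (z t))
      (ε • reduced (scaledField J (o.Bi t) (o.dipole k₁ k₂ (z a) a) (z t))) (Icc a b) t := by
    intro t ht
    have := (reducedₗ.toContinuousLinearMap.hasFDerivAt (x := z t)).comp_hasDerivWithinAt t
      (hz t ht)
    exact this.congr_deriv (map_smul reducedₗ ε _)
  have h := norm_image_sub_le_of_norm_deriv_le_segment'
    (f := fun t => reduced (z t) - ε • Ψ t)
    (fun t ht => (hred t ht).sub ((hΨ t ht).const_smul ε))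
    (C := ε * (N * ((M * T + 1) * (ε * r + r ^ 2)))) (fun t ht => by
      have ht' := Ico_subset_Icc_self ht
      rw [← smul_sub, norm_smul, Real.norm_of_nonneg hε.le]
      refine mul_le_mul_of_nonneg_left ((hN r (z t) (z a) t a (by linarith) le_rfl
        (hgr t ht')).trans ?_) hε.le
      refine mul_le_mul_of_nonneg_left ?_ hN0.le
      have h1 := hdisp t ht'
      have h2 : 0 ≤ M * T * r ^ 2 := by positivity
      have h3 : 0 ≤ ε * r := by positivity
      nlinarith) b (right_mem_Icc.2 hab)
  have hΨa : Ψ a = 0 := by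
    have : I a = 0 := by ext i j; simp [I]
    simp only [Ψ, this]
    ext (i | i) <;> simp
  have hIb : I b = T • o.H₂ k T := by
    ext i j
    rw [Matrix.smul_apply, o.H₂_apply hR hn k hT.ne', smul_eq_mul, mul_div_cancel₀ _ hT.ne']
    simp only [I, Orbit.G₂, Matrix.of_apply, hb, hak]
    rw [show (k : ℝ) * T + T = (k + 1) * T by ring]
  have hΨb : Ψ b = T • averagedMatrix J k₁ k₂ (o.L k T) *ᵥ reduced (z a) := by
    have h1 : b - a = T := by linarith
    simp only [Ψ, hIb, h1, averagedMatrix, reduced, Matrix.fromBlocks_mulVec, Sum.elim_comp_inl,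
      Sum.elim_comp_inr, Orbit.L, ← hak]
    ext (i | i)
    · simp [Matrix.smul_mulVec]
    · refine congrFun (show -(J⁻¹ *ᵥ ((T • o.H₂ k T) *ᵥ ((skew (o.Bi a))ᵀ *ᵥ v)))
        = T • (-(k₁ • (J⁻¹ * (o.H₂ k T * (skew (o.Bi a))ᵀ))) *ᵥ qv (z a).1
          + -(k₂ • (J⁻¹ * (o.H₂ k T * (skew (o.Bi a))ᵀ))) *ᵥ (z a).2) from ?_) i
      simp only [v, Matrix.neg_mulVec, Matrix.smul_mulVec, Matrix.mulVec_smul, Matrix.mulVec_add,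
        ← Matrix.mulVec_mulVec, smul_add, smul_neg]
      module
  simp only [hΨa, hΨb, smul_zero, sub_zero, smul_smul] at h
  rw [show reduced (z b) - reduced (z a)
        - (ε * T) • averagedMatrix J k₁ k₂ (o.L k T) *ᵥ reduced (z a)
    = reduced (z b) - (ε * T) • averagedMatrix J k₁ k₂ (o.L k T) *ᵥ reduced (z a)
        - reduced (z a) by abel]
  refine h.trans (le_of_eq ?_)
  rw [show b - a = T by linarith]
  ring

end Arc

/-! ### Existence of solutions on one sampling interval. -/

theorem contDiff_scaledField (o : Orbit) (hR : o.R ≠ 0) (J : Matrix (Fin 3) (Fin 3) ℝ)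
    (m : Fin 3 → ℝ) : ContDiff ℝ 1 fun p : ℝ × State => scaledField J (o.Bi p.1) m p.2 := by
  obtain ⟨a, b, c, h⟩ := o.exists_Bi_eq hR
  have hB : ∀ i, ContDiff ℝ 1 fun t => o.Bi t i := fun i => by
    simp only [h, Pi.add_apply, Pi.smul_apply, smul_eq_mul]
    fun_prop
  have hq : ∀ i, ContDiff ℝ 1 fun p : ℝ × State => p.2.1 i := fun i => by fun_prop
  have hw : ∀ i, ContDiff ℝ 1 fun p : ℝ × State => p.2.2 i := fun i => by fun_prop
  have hBp : ∀ i, ContDiff ℝ 1 fun p : ℝ × State => o.Bi p.1 i := fun i => (hB i).comp contDiff_fst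
  have hmul : ∀ {m n : ℕ} {A : ℝ × State → Matrix (Fin m) (Fin n) ℝ} {v : ℝ × State → Fin n → ℝ},
      (∀ i j, ContDiff ℝ 1 fun p => A p i j) → (∀ i, ContDiff ℝ 1 fun p => v p i) →
      ∀ i, ContDiff ℝ 1 fun p => (A p *ᵥ v p) i := by
    intro m n A v hA hv i
    simp only [Matrix.mulVec, dotProduct]
    exact ContDiff.sum fun j _ => (hA i j).mul (hv j)
  have hskew : ∀ {v : ℝ × State → Fin 3 → ℝ}, (∀ i, ContDiff ℝ 1 fun p => v p i) →
      ∀ i j, ContDiff ℝ 1 fun p => skew (v p) i j := by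
    intro v hv i j
    fin_cases i <;> fin_cases j <;> simp [skew] <;> fun_prop
  have hqv : ∀ i, ContDiff ℝ 1 fun p : ℝ × State => qv p.2.1 i := fun i => by
    fin_cases i <;> simp [qv] <;> fun_prop
  have hW : ∀ i j, ContDiff ℝ 1 fun p : ℝ × State => W p.2.1 i j := fun i j => by
    fin_cases i <;> fin_cases j <;> simp [W] <;> fun_prop
  have hatt : ∀ i j, ContDiff ℝ 1 fun p : ℝ × State => attitude p.2.1 i j := fun i j => by
    simp only [attitude, Matrix.sub_apply, Matrix.add_apply, Matrix.smul_apply, smul_eq_mul,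
      Matrix.vecMulVec_apply, dotProduct]
    have := hskew hqv i j
    fun_prop
  refine ContDiff.prodMk (contDiff_pi.2 (hmul hW hw)) (contDiff_pi.2 (hmul (fun i j => by fun_prop) ?_))
  intro i
  simp only [torque, Pi.sub_apply, Pi.neg_apply]
  exact (hmul (hskew hw) (hmul (fun i j => by fun_prop) hw) i).neg.sub
    (hmul (hskew (hmul hatt hBp)) (fun i => by fun_prop) i)

/-- Picard–Lindelöf on the ball of radius `1/2` about `z₀`: it lies within distance `1` of the
equilibrium, so the speed is at most `ε M`, and `ε M T ≤ 1/2` keeps the solution in the ball for the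
whole period. -/
theorem exists_isArc (o : Orbit) (hR : o.R ≠ 0) (J : Matrix (Fin 3) (Fin 3) ℝ)
    {k₁ k₂ ε a b T M : ℝ} (hT : 0 < T) (hb : b = a + T)
    (hM0 : 0 < M) (hε : 0 < ε) (hεM : ε * M * T ≤ 1 / 2)
    (hM : ∀ (r : ℝ) (z z₀ : State) (t t₀ : ℝ), r ≤ 1 → ‖z₀ - zbar‖ ≤ r → ‖z - zbar‖ ≤ 2 * r →
      ‖scaledField J (o.Bi t) (o.dipole k₁ k₂ z₀ t₀) z‖ ≤ M * r)
    {z₀ : State} (hz₀ : ‖z₀ - zbar‖ ≤ 1 / 2) :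
    ∃ z : ℝ → State, z a = z₀ ∧ IsArc o J k₁ k₂ ε a b z := by
  have hab : a ≤ b := by linarith
  set F : ℝ → State → State := fun t z => ε • scaledField J (o.Bi t) (o.dipole k₁ k₂ z₀ a) z
  have hF : ContDiff ℝ 1 fun p : ℝ × State => F p.1 p.2 :=
    (contDiff_scaledField o hR J _).const_smul ε
  obtain ⟨K, hK⟩ := hF.contDiffOn.exists_lipschitzOnWith (s := Icc a b ×ˢ Metric.closedBall z₀ (1 / 2))
    one_ne_zero ((convex_Icc a b).prod (convex_closedBall _ _))
    (isCompact_Icc.prod (isCompact_closedBall _ _))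
  have hpl : IsPicardLindelof F (⟨a, left_mem_Icc.2 hab⟩ : Icc a b) z₀ (1 / 2) 0
      ⟨ε * M, by positivity⟩ K := by
    refine ⟨fun t ht => ?_, fun x hx => ?_, fun t ht x hx => ?_, ?_⟩
    · intro x hx y hy
      have := hK (x := (t, x)) ⟨ht, by simpa using hx⟩ (y := (t, y)) ⟨ht, by simpa using hy⟩
      simpa [Prod.edist_eq] using this
    · exact (hF.continuous.comp (by fun_prop : Continuous fun t : ℝ => (t, x))).continuousOn
    · have hx' : ‖x - z₀‖ ≤ 1 / 2 := by simpa [dist_eq_norm] using hx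
      have h1 : ‖x - zbar‖ ≤ 2 * (1 / 2) := by
        have := norm_add_le (x - z₀) (z₀ - zbar)
        rw [sub_add_sub_cancel] at this
        linarith
      have h2 := hM (1 / 2) x z₀ t a (by norm_num) hz₀ h1
      change ‖ε • _‖ ≤ ε * M
      rw [norm_smul, Real.norm_of_nonneg hε.le]
      refine mul_le_mul_of_nonneg_left (h2.trans ?_) hε.le
      linarith
    · change ε * M * max (b - a) (a - a) ≤ ((1 / 2 : NNReal) : ℝ) - ((0 : NNReal) : ℝ)
      rw [sub_self, max_eq_left (by linarith), hb]
      simp only [add_sub_cancel_left, NNReal.coe_div, NNReal.coe_one, NNReal.coe_ofNat,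
        NNReal.coe_zero, sub_zero]
      exact hεM
  obtain ⟨z, hz, hz'⟩ := hpl.exists_eq_forall_mem_Icc_hasDerivWithinAt₀
  change z a = z₀ at hz
  exact ⟨z, hz, fun t ht => by rw [hz]; exact hz' t ht⟩

/-! ### Conservation of the quaternion norm and comparison of state norms. -/

theorem dotProduct_W_mulVec (q : Fin 4 → ℝ) (w : Fin 3 → ℝ) : q ⬝ᵥ W q *ᵥ w = 0 := by
  simp [W, Matrix.mulVec, dotProduct, Fin.sum_univ_three, Fin.sum_univ_four]
  ring

theorem IsArc.hasDerivWithinAt_fst {o : Orbit} {J : Matrix (Fin 3) (Fin 3) ℝ} {k₁ k₂ ε a b : ℝ}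
    {z : ℝ → State} (hz : IsArc o J k₁ k₂ ε a b z) {t : ℝ} (ht : t ∈ Icc a b) :
    HasDerivWithinAt (fun t => (z t).1) (ε • (W (z t).1 *ᵥ (z t).2)) (Icc a b) t :=
  (hasFDerivAt_fst (𝕜 := ℝ) (p := z t)).comp_hasDerivWithinAt t (hz t ht)

theorem IsArc.hasDerivWithinAt_snd {o : Orbit} {J : Matrix (Fin 3) (Fin 3) ℝ} {k₁ k₂ ε a b : ℝ}
    {z : ℝ → State} (hz : IsArc o J k₁ k₂ ε a b z) {t : ℝ} (ht : t ∈ Icc a b) :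
    HasDerivWithinAt (fun t => (z t).2)
      (ε • (J⁻¹ *ᵥ torque J (o.Bi t) (o.dipole k₁ k₂ (z a) a) (z t))) (Icc a b) t :=
  (hasFDerivAt_snd (𝕜 := ℝ) (p := z t)).comp_hasDerivWithinAt t (hz t ht)

theorem IsArc.dotProduct_self {o : Orbit} {J : Matrix (Fin 3) (Fin 3) ℝ} {k₁ k₂ ε a b : ℝ}
    {z : ℝ → State} (hz : IsArc o J k₁ k₂ ε a b z) {t : ℝ} (ht : t ∈ Icc a b) :
    (z t).1 ⬝ᵥ (z t).1 = (z a).1 ⬝ᵥ (z a).1 := by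
  have h := norm_image_sub_le_of_norm_deriv_le_segment' (f := fun t => (z t).1 ⬝ᵥ (z t).1)
    (f' := fun _ => 0) (a := a) (b := b) (C := 0) (fun t ht => by
      have h1 := hasDerivWithinAt_pi.1 (hz.hasDerivWithinAt_fst ht)
      have h2 := HasDerivWithinAt.fun_sum (u := Finset.univ) fun i _ => (h1 i).mul (h1 i)
      refine h2.congr_deriv ?_
      have h3 := dotProduct_W_mulVec (z t).1 (z t).2
      rw [dotProduct] at h3
      calc _ = 2 * ε * ∑ i, (z t).1 i * (W (z t).1 *ᵥ (z t).2) i := by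
            rw [Finset.mul_sum]
            refine Finset.sum_congr rfl fun i _ => ?_
            simp only [Pi.smul_apply, smul_eq_mul]
            ring
        _ = 0 := by rw [h3, mul_zero]) (fun t _ => by simp) t ht
  rw [zero_mul] at h
  exact sub_eq_zero.1 (norm_le_zero_iff.1 h)

theorem norm_toLp_sq {ι : Type*} [Fintype ι] (x : ι → ℝ) : ‖WithLp.toLp 2 x‖ ^ 2 = x ⬝ᵥ x := by
  rw [EuclideanSpace.norm_sq_eq]
  simp [dotProduct, sq]

theorem norm_toLp_eq_one_iff {ι : Type*} [Fintype ι] (x : ι → ℝ) :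
    ‖WithLp.toLp 2 x‖ = 1 ↔ x ⬝ᵥ x = 1 := by
  rw [← norm_toLp_sq, pow_eq_one_iff_of_nonneg (norm_nonneg _) two_ne_zero]

/-- On the unit sphere `(1 - q_4)(1 + q_4) = q_v · q_v`, and `1 + q_4 ≥ 1` near the target, so `q_4
- 1` is controlled by `q_v`. -/
theorem norm_sub_zbar_le_three_mul {z : State} (hu : z.1 ⬝ᵥ z.1 = 1) (hz : ‖z - zbar‖ ≤ 1 / 2) :
    ‖z - zbar‖ ≤ 3 * ‖reduced z‖ := by
  have h3 := (abs_sub_one_le z.1).trans ((norm_fst_sub_le z).trans hz)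
  have hv : ‖qv z.1‖ ≤ 1 / 2 := (norm_qv_le z.1).trans ((norm_fst_sub_le z).trans hz)
  have hred : ‖reduced z‖ = max ‖qv z.1‖ ‖z.2‖ := norm_sumElim _ _
  have hvr : ‖qv z.1‖ ≤ ‖reduced z‖ := hred ▸ le_max_left _ _
  have hwr : ‖z.2‖ ≤ ‖reduced z‖ := hred ▸ le_max_right _ _
  have hr : 0 ≤ ‖reduced z‖ := norm_nonneg _
  have hsq : (1 - z.1 3) * (1 + z.1 3) = qv z.1 ⬝ᵥ qv z.1 := by
    simp only [dotProduct, Fin.sum_univ_four, Fin.sum_univ_three, qv, Matrix.cons_val_zero,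
      Matrix.cons_val_one, Matrix.cons_val] at hu ⊢
    linarith
  have hdot := abs_dotProduct_le_three (qv z.1) (qv z.1)
  have hq3 : |z.1 3 - 1| ≤ 3 * ‖reduced z‖ := by
    rw [← hsq, abs_mul, abs_sub_comm] at hdot
    have h1 : 1 ≤ |1 + z.1 3| := by
      rw [abs_le] at h3
      rw [abs_of_nonneg (by linarith)]; linarith
    have h2 : 3 * ‖qv z.1‖ * ‖qv z.1‖ ≤ 3 * ‖reduced z‖ * 1 := by
      gcongr; linarith
    nlinarith [abs_nonneg (z.1 3 - 1)]
  refine max_le ((pi_norm_le_iff_of_nonneg (by positivity)).2 fun i => ?_) ?_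
  · have hvi : ∀ j, |qv z.1 j| ≤ 3 * ‖reduced z‖ := fun j =>
      (norm_le_pi_norm (qv z.1) j).trans (hvr.trans (by linarith))
    fin_cases i
    · simpa [zbar, qbar, qv] using hvi 0
    · simpa [zbar, qbar, qv] using hvi 1
    · simpa [zbar, qbar, qv] using hvi 2
    · simpa [zbar, qbar] using hq3
  · simpa [zbar] using hwr.trans (by linarith)

theorem norm_le_norm_toLp {ι : Type*} [Fintype ι] (x : ι → ℝ) : ‖x‖ ≤ ‖WithLp.toLp 2 x‖ :=
  (pi_norm_le_iff_of_nonneg (norm_nonneg _)).2 fun i => PiLp.norm_apply_le (WithLp.toLp 2 x) i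

theorem norm_sub_zbar_le_stateErr (q : Fin 4 → ℝ) (ω : Fin 3 → ℝ) {ε : ℝ} (hε : 0 < ε)
    (hε1 : ε ≤ 1) : ‖((q, ε⁻¹ • ω) : State) - zbar‖ ≤ ε⁻¹ * stateErr q ω := by
  have h := norm_le_norm_toLp (Sum.elim (q - qbar) ω)
  rw [norm_sumElim] at h
  have h1 : ‖q - qbar‖ ≤ stateErr q ω := (le_max_left _ _).trans h
  have h2 : ‖ω‖ ≤ stateErr q ω := (le_max_right _ _).trans h
  have h3 : 1 ≤ ε⁻¹ := (one_le_inv₀ hε).2 hε1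
  refine max_le ?_ ?_
  · refine h1.trans ?_
    exact le_mul_of_one_le_left ((norm_nonneg _).trans h1) h3
  · change ‖ε⁻¹ • ω - 0‖ ≤ _
    rw [sub_zero, norm_smul, Real.norm_of_nonneg (by positivity)]
    gcongr

/-- There are seven coordinates, and `√7 ≤ 3`; passing from `w` to `ω` costs nothing as `ε ≤ 1`. -/
theorem stateErr_le_norm_sub_zbar (q : Fin 4 → ℝ) (ω : Fin 3 → ℝ) {ε : ℝ} (hε : 0 < ε)
    (hε1 : ε ≤ 1) : stateErr q ω ≤ 3 * ‖((q, ε⁻¹ • ω) : State) - zbar‖ := by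
  set r := ‖((q, ε⁻¹ • ω) : State) - zbar‖
  have hr : 0 ≤ r := norm_nonneg _
  have h1 : ‖q - qbar‖ ≤ r := norm_fst_sub_le (q, ε⁻¹ • ω)
  have h2 : ‖ω‖ ≤ r := by
    have h := norm_snd_le' (q, ε⁻¹ • ω)
    change ‖ε⁻¹ • ω‖ ≤ r at h
    rw [norm_smul, Real.norm_of_nonneg (by positivity), inv_mul_le_iff₀ hε] at h
    exact h.trans (mul_le_of_le_one_left hr hε1)
  refine le_of_sq_le_sq ?_ (by positivity)
  rw [stateErr, norm_toLp_sq, sumElim_dotProduct_sumElim]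
  have g1 : ∀ i, (q - qbar) i * (q - qbar) i ≤ r ^ 2 := fun i => by
    have := (norm_le_pi_norm (q - qbar) i).trans h1
    rw [Real.norm_eq_abs] at this
    nlinarith [sq_abs ((q - qbar) i), abs_nonneg ((q - qbar) i)]
  have g2 : ∀ i, ω i * ω i ≤ r ^ 2 := fun i => by
    have := (norm_le_pi_norm ω i).trans h2
    rw [Real.norm_eq_abs] at this
    nlinarith [sq_abs (ω i), abs_nonneg (ω i)]
  simp only [dotProduct, Fin.sum_univ_four, Fin.sum_univ_three]
  nlinarith [g1 0, g1 1, g1 2, g1 3, g2 0, g2 1, g2 2]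

/-! ### Exponential decay at the sampling instants. -/

theorem averagedMatrix_add_sub (J : Matrix (Fin 3) (Fin 3) ℝ) (k₁ k₂ : ℝ)
    (M N K : Matrix (Fin 3) (Fin 3) ℝ) : averagedMatrix J k₁ k₂ (M + (N - K))
      = averagedMatrix J k₁ k₂ M + (averagedMatrix J k₁ k₂ N - averagedMatrix J k₁ k₂ K) := by
  ext (i | i) (j | j) <;> simp [averagedMatrix, Matrix.mul_add, Matrix.mul_sub] <;> ring

theorem exists_entrySum_averagedMatrix_le (J : Matrix (Fin 3) (Fin 3) ℝ) (k₁ k₂ C : ℝ) :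
    ∃ B ≥ 0, ∀ M : Matrix (Fin 3) (Fin 3) ℝ, (∀ i j, |M i j| ≤ C) →
      entrySum (averagedMatrix J k₁ k₂ M) ≤ B := by
  have hK : IsCompact (Set.pi univ fun _ : Fin 3 => Set.pi univ fun _ : Fin 3 => Icc (-C) C) :=
    isCompact_univ_pi fun _ => isCompact_univ_pi fun _ => isCompact_Icc
  have hcont : Continuous fun M : Fin 3 → Fin 3 → ℝ => entrySum (averagedMatrix J k₁ k₂ M) :=
    continuous_finsetSum _ fun i _ => continuous_finsetSum _ fun j _ =>
      ((continuous_averagedMatrix J k₁ k₂).matrix_elem i j).abs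
  obtain ⟨B, hB⟩ := hK.exists_bound_of_continuousOn hcont.continuousOn
  refine ⟨max B 0, le_max_right _ _, fun M hM => ?_⟩
  exact (le_abs_self _).trans ((hB M fun i _ j _ => abs_le.1 (hM i j)).trans (le_max_left _ _))

/-- These partial sums generate the bounded sequence `S` of the averaging theorem; one bound serves
all initial instants `k₀`. -/
theorem Orbit.exists_bound_sum_L (o : Orbit) (hR : o.R ≠ 0) (hn : 0 < o.n) {T : ℝ} (hT : 0 < T) :
    ∃ C, ∀ (k₀ j : ℕ) (i l : Fin 3),
      |(∑ m ∈ Finset.range j, (o.L ((k₀ + m : ℕ) : ℤ) T - o.Lav T)) i l| ≤ C := by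
  choose C hC using fun i l => o.hasMean_L hR hn hT i l
  have hC0 : ∀ i l, 0 ≤ C i l := fun i l => (abs_nonneg _).trans (hC i l 0 0)
  refine ⟨∑ i, ∑ l, C i l, fun k₀ j i l => ?_⟩
  have h1 : C i l ≤ ∑ i, ∑ l, C i l :=
    (Finset.single_le_sum (fun l _ => hC0 i l) (Finset.mem_univ l)).trans
      (Finset.single_le_sum (f := fun i => ∑ l, C i l)
        (fun i _ => Finset.sum_nonneg fun l _ => hC0 i l) (Finset.mem_univ i))
  -- `HasMean` sums from `s + 1`, hence `s = k₀ - 1`.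
  refine le_trans (le_of_eq ?_) ((hC i l (k₀ - 1) j).trans h1)
  rw [Matrix.sum_apply]
  simp [Finset.sum_sub_distrib]

/-- Local exponential decay at the sampling instants for small `ε`, together with the estimate and
the existence of the solution on a single sampling interval. -/
theorem exists_decay_of_isArc (o : Orbit) (hR : o.R ≠ 0) (hn : 0 < o.n)
    (J : Matrix (Fin 3) (Fin 3) ℝ) {k₁ k₂ : ℝ} (hk₁ : 0 < k₁) (hk₂ : 0 < k₂)
    {T : ℝ} (hT : 0 < T) {P : Matrix (Fin 3 ⊕ Fin 3) (Fin 3 ⊕ Fin 3) ℝ}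
    (hP : IsLyapunovSolution (averagedMatrix J k₁ k₂ (o.Lav T)) P) :
    ∃ ε₁ > 0, ∀ ε, 0 < ε → ε ≤ ε₁ → ε ≤ 1 ∧
      (∀ (a : ℝ) (z : ℝ → State), IsArc o J k₁ k₂ ε a (a + T) z → ‖z a - zbar‖ ≤ 1 / 2 →
        ∀ t ∈ Icc a (a + T), ‖z t - zbar‖ ≤ 2 * ‖z a - zbar‖) ∧
      (∀ (a : ℝ) (z₀ : State), ‖z₀ - zbar‖ ≤ 1 / 2 →
        ∃ z : ℝ → State, z a = z₀ ∧ IsArc o J k₁ k₂ ε a (a + T) z) ∧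
      ∃ δ > 0, ∃ K > 0, ∃ κ, 0 < κ ∧ κ < 1 ∧ ∀ (k₀ : ℕ) (ζ : ℕ → State),
        (ζ 0).1 ⬝ᵥ (ζ 0).1 = 1 → ‖ζ 0 - zbar‖ ≤ δ →
        (∀ j, ‖ζ j - zbar‖ ≤ 1 / 2 → ∃ z : ℝ → State, z ((k₀ + j : ℕ) * T) = ζ j ∧
          z ((k₀ + j : ℕ) * T + T) = ζ (j + 1) ∧
          IsArc o J k₁ k₂ ε ((k₀ + j : ℕ) * T) ((k₀ + j : ℕ) * T + T) z) →
        ∀ j, (ζ j).1 ⬝ᵥ (ζ j).1 = 1 ∧ ‖ζ j - zbar‖ ≤ 1 / 2 ∧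
          ‖ζ j - zbar‖ ≤ K * κ ^ j * ‖ζ 0 - zbar‖ := by
  obtain ⟨M, hM0, hM⟩ := exists_norm_scaledField_le o hR J hk₁.le hk₂.le
  obtain ⟨N, hN0, hN⟩ := exists_norm_reduced_sub_linearField_le o hR J hk₁.le hk₂.le
  obtain ⟨C, hC⟩ := o.exists_bound_sum_L hR hn hT
  obtain ⟨B₁, hB₁, hB₁C⟩ := exists_entrySum_averagedMatrix_le J k₁ k₂ C
  obtain ⟨hPpos, hPA⟩ := hP
  have hPs := ((posDef_iff_quadForm P).1 hPpos).1
  set A := averagedMatrix J k₁ k₂ (o.Lav T)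
  have hA : ∀ x, 2 * (x ⬝ᵥ (P * A) *ᵥ x) ≤ -1 * ‖x‖ ^ 2 := by
    intro x
    have h1 : x ⬝ᵥ (P * A + Aᵀ * P) *ᵥ x = 2 * (x ⬝ᵥ (P * A) *ᵥ x) := by
      rw [Matrix.add_mulVec, dotProduct_add, show Aᵀ * P = (P * A)ᵀ by
        rw [Matrix.transpose_mul, hPs], dotProduct_transpose_mulVec]
      ring
    rw [← h1, hPA, Matrix.neg_mulVec, Matrix.one_mulVec, dotProduct_neg, ← norm_toLp_sq]
    have h2 : ‖x‖ ^ 2 ≤ ‖WithLp.toLp 2 x‖ ^ 2 := by gcongr; exact norm_le_norm_toLp x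
    linarith
  -- The factor 9 comes from `‖ζ - zbar‖ ≤ 3 ‖reduced ζ‖` in a quadratic remainder. The radius
  -- `1/12` used next gives `‖ζ - zbar‖ ≤ 1/4`, so that after a possible doubling the next sample is
  -- still within `1/2`.
  have hC₁ : 0 ≤ 9 * (N * (M * T + 1) * T) := by positivity
  obtain ⟨ε₁, hε₁, h⟩ := exists_discrete_averaging hPpos one_pos hA hT
    (add_nonneg hB₁ (entrySum_nonneg (averagedMatrix J k₁ k₂ 0))) hC₁
    (show (0 : ℝ) < 1 / 12 by norm_num)
  refine ⟨min ε₁ (min 1 (1 / (2 * (M * T)))), by positivity, fun ε hε hεle => ?_⟩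
  have hεM : ε * M * T ≤ 1 / 2 := by
    have h1 := hεle.trans ((min_le_right _ _).trans (min_le_right _ _))
    rw [le_div_iff₀ (by positivity)] at h1
    linarith
  refine ⟨hεle.trans ((min_le_right _ _).trans (min_le_left _ _)),
    fun a z hz ha => hz.norm_sub_zbar_le hT rfl hε hεM hM ha,
    fun a z₀ hz₀ => exists_isArc o hR J hT rfl hM0 hε hεM hM hz₀, ?_⟩
  obtain ⟨δ, hδ, K, hK, κ, hκ0, hκ1, h⟩ := h ε hε (hεle.trans (min_le_left _ _))
  refine ⟨min δ (1 / 2), by positivity, 3 * K, by positivity, κ, hκ0, hκ1,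
    fun k₀ ζ hu h0 harc => ?_⟩
  let D : ℕ → Matrix (Fin 3) (Fin 3) ℝ := fun j =>
    ∑ m ∈ Finset.range j, (o.L ((k₀ + m : ℕ) : ℤ) T - o.Lav T)
  -- `averagedMatrix` is affine in its last argument; subtracting its value at `0` leaves the linear
  -- part, so increments of `S` turn `A` into the matrix of `L(k₀ + j, T)`.
  have hdec := h (fun j => averagedMatrix J k₁ k₂ (D j) - averagedMatrix J k₁ k₂ 0)
    (fun j => reduced (ζ j)) (fun j => (ζ j).1 ⬝ᵥ (ζ j).1 = 1 ∧ ‖ζ j - zbar‖ ≤ 1 / 2)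
    (fun j => by
      have h1 := hB₁C (D j) fun i l => hC k₀ j i l
      have h2 : ∀ X Y : Matrix (Fin 3 ⊕ Fin 3) (Fin 3 ⊕ Fin 3) ℝ,
          entrySum (X - Y) ≤ entrySum X + entrySum Y := fun X Y => by
        simp only [entrySum, ← Finset.sum_add_distrib]
        exact Finset.sum_le_sum fun i _ => Finset.sum_le_sum fun j _ => abs_sub _ _
      exact (h2 _ _).trans (by linarith))
    ⟨hu, h0.trans (min_le_right _ _)⟩
    ((norm_reduced_le _).trans (h0.trans (min_le_left _ _)))
    (fun j hQ hx => by
      obtain ⟨z, hz0, hz1, hz⟩ := harc j hQ.2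
      have hζ := norm_sub_zbar_le_three_mul hQ.1 hQ.2
      have ha : ‖z ((k₀ + j : ℕ) * T) - zbar‖ ≤ 1 / 2 := by rw [hz0]; exact hQ.2
      have hmem : ((k₀ + j : ℕ) * T + T : ℝ) ∈ Icc ((k₀ + j : ℕ) * T : ℝ) ((k₀ + j : ℕ) * T + T) :=
        right_mem_Icc.2 (by linarith)
      have hgr := hz.norm_sub_zbar_le hT rfl hε hεM hM ha _ hmem
      have hun := hz.dotProduct_self hmem
      rw [hz0, hz1] at hgr hun
      refine ⟨⟨hun.trans hQ.1, hgr.trans (by linarith)⟩, ?_⟩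
      have hst := hz.norm_reduced_step_le hR hn.ne' (k := ((k₀ + j : ℕ) : ℤ)) hT (by push_cast; rfl)
        rfl hM0 hε hεM hM hN0 hN ha
      rw [hz0, hz1] at hst
      have e : A *ᵥ reduced (ζ j) + (averagedMatrix J k₁ k₂ (D (j + 1))
          - averagedMatrix J k₁ k₂ 0) *ᵥ reduced (ζ j)
          - (averagedMatrix J k₁ k₂ (D j) - averagedMatrix J k₁ k₂ 0) *ᵥ reduced (ζ j)
          = averagedMatrix J k₁ k₂ (o.L ((k₀ + j : ℕ) : ℤ) T) *ᵥ reduced (ζ j) := by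
        rw [show D (j + 1) = D j + (o.L ((k₀ + j : ℕ) : ℤ) T - o.Lav T) from
          Finset.sum_range_succ _ _, averagedMatrix_add_sub, ← Matrix.add_mulVec,
          ← Matrix.sub_mulVec]
        congr 1
        simp only [A]
        abel
      rw [e]
      refine hst.trans ?_
      calc _ ≤ N * (M * T + 1) * T * ε * (ε * (3 * ‖reduced (ζ j)‖) + (3 * ‖reduced (ζ j)‖) ^ 2) := by
            gcongr
        _ ≤ N * (M * T + 1) * T * ε * (9 * (ε * ‖reduced (ζ j)‖ + ‖reduced (ζ j)‖ ^ 2)) := by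
            gcongr
            have : 0 ≤ ε * ‖reduced (ζ j)‖ := by positivity
            linarith
        _ = _ := by ring)
  intro j
  obtain ⟨⟨h1, h2⟩, -, h3⟩ := hdec j
  refine ⟨h1, h2, (norm_sub_zbar_le_three_mul h1 h2).trans ?_⟩
  calc 3 * ‖reduced (ζ j)‖ ≤ 3 * (K * κ ^ j * ‖ζ 0 - zbar‖) := by
        gcongr
        exact h3.trans (by gcongr; exact norm_reduced_le _)
    _ = _ := by ring

/-! ### Return to the original closed loop. -/

theorem Orbit.feedback_smul (o : Orbit) (k₁ k₂ ε : ℝ) (q : Fin 4 → ℝ) (w : Fin 3 → ℝ) (t : ℝ) :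
    o.feedback k₁ k₂ ε q (ε • w) t = ε ^ 2 • o.dipole k₁ k₂ (q, w) t := by
  rw [Orbit.feedback, Orbit.dipole, Orbit.Bb, ← Matrix.mulVec_smul]
  congr 1
  module

theorem torque_smul (o : Orbit) (J : Matrix (Fin 3) (Fin 3) ℝ) (ε : ℝ) (m : Fin 3 → ℝ)
    (q : Fin 4 → ℝ) (w : Fin 3 → ℝ) (t : ℝ) :
    -(skew (ε • w) *ᵥ (J *ᵥ (ε • w))) - skew (o.Bb q t) *ᵥ (ε ^ 2 • m)
      = ε ^ 2 • torque J (o.Bi t) m (q, w) := by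
  simp only [torque, Orbit.Bb, skew_smul, Matrix.mulVec_smul, Matrix.smul_mulVec]
  module

theorem IsSolution.isArc {o : Orbit} {J : Matrix (Fin 3) (Fin 3) ℝ} (hJ : IsUnit J.det)
    {k₁ k₂ ε T : ℝ} (hε : ε ≠ 0) {k₀ : ℕ} {q : ℝ → Fin 4 → ℝ} {ω : ℝ → Fin 3 → ℝ}
    (h : IsSolution o J k₁ k₂ ε T k₀ q ω) {k : ℕ} (hk : k₀ ≤ k) :
    IsArc o J k₁ k₂ ε (k * T) ((k + 1) * T) fun t => (q t, ε⁻¹ • ω t) := by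
  intro t ht
  have hω : ∀ t, ω t = ε • ε⁻¹ • ω t := fun t => by rw [smul_smul, mul_inv_cancel₀ hε, one_smul]
  have h1 := h.kinematics k hk t ht
  have h2 := (HasDerivWithinAt.const_mulVec J⁻¹ (h.dynamics k hk t ht)).const_smul ε⁻¹
  simp only [Matrix.mulVec_mulVec, Matrix.nonsing_inv_mul _ hJ, Matrix.one_mulVec] at h2
  refine (h1.prodMk h2).congr_deriv ?_
  rw [scaledField, Prod.smul_mk]
  refine Prod.ext ?_ ?_
  · change W (q t) *ᵥ ω t = ε • (W (q t) *ᵥ (ε⁻¹ • ω t))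
    rw [← Matrix.mulVec_smul, ← hω]
  · have e := torque_smul o J ε (o.dipole k₁ k₂ (q (k * T), ε⁻¹ • ω (k * T)) (k * T)) (q t)
      (ε⁻¹ • ω t) t
    rw [← o.feedback_smul, ← hω, ← hω] at e
    dsimp only
    rw [← Matrix.mulVec_mulVec, e, Matrix.mulVec_smul, smul_smul]
    congr 1
    field_simp

theorem isSolution_of_isArc {o : Orbit} {J : Matrix (Fin 3) (Fin 3) ℝ} (hJ : IsUnit J.det)
    {k₁ k₂ ε T : ℝ} (hT : 0 < T) {k₀ : ℕ} {z : ℝ → State}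
    (hz : ∀ k : ℕ, k₀ ≤ k → IsArc o J k₁ k₂ ε (k * T) ((k + 1) * T) z)
    (hu : ∀ k : ℕ, k₀ ≤ k → (z (k * T)).1 ⬝ᵥ (z (k * T)).1 = 1) :
    IsSolution o J k₁ k₂ ε T k₀ (fun t => (z t).1) (fun t => ε • (z t).2) := by
  refine ⟨fun t ht => ?_, fun k hk t ht => ?_, fun k hk t ht => ?_⟩
  · have ht0 : 0 ≤ t / T := div_nonneg (le_trans (by positivity) ht) hT.le
    have hk : k₀ ≤ ⌊t / T⌋₊ := Nat.le_floor ((le_div_iff₀ hT).2 ht)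
    have h1 : (⌊t / T⌋₊ : ℝ) * T ≤ t := (le_div_iff₀ hT).1 (Nat.floor_le ht0)
    have h2 : t ≤ (⌊t / T⌋₊ + 1) * T := ((div_lt_iff₀ hT).1 (Nat.lt_floor_add_one _)).le
    rw [norm_toLp_eq_one_iff]
    exact ((hz _ hk).dotProduct_self ⟨h1, h2⟩).trans (hu _ hk)
  · refine ((hz k hk).hasDerivWithinAt_fst ht).congr_deriv ?_
    rw [Matrix.mulVec_smul]
  · refine (HasDerivWithinAt.const_mulVec J
      (((hz k hk).hasDerivWithinAt_snd ht).const_smul ε)).congr_deriv ?_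
    rw [o.feedback_smul, torque_smul, Matrix.mulVec_smul, Matrix.mulVec_smul,
      Matrix.mulVec_mulVec, Matrix.mul_nonsing_inv _ hJ, Matrix.one_mulVec, smul_smul, sq]

theorem IsArc.congr {o : Orbit} {J : Matrix (Fin 3) (Fin 3) ℝ} {k₁ k₂ ε a b : ℝ}
    {z y : ℝ → State} (hz : IsArc o J k₁ k₂ ε a b z) (hab : a ≤ b) (h : EqOn y z (Icc a b)) :
    IsArc o J k₁ k₂ ε a b y := fun t ht => by
  rw [h ht, h (left_mem_Icc.2 hab)]
  exact (hz t ht).congr_of_mem h ht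

/-- Concatenation of arcs on consecutive sampling intervals. -/
theorem exists_concat_isArc {o : Orbit} {J : Matrix (Fin 3) (Fin 3) ℝ} {k₁ k₂ ε T : ℝ} (hT : 0 < T)
    (k₀ : ℕ) {ζ : ℕ → State} {Z : ℕ → ℝ → State}
    (h0 : ∀ j, Z j ((k₀ + j : ℕ) * T) = ζ j)
    (h1 : ∀ j, Z j ((k₀ + j : ℕ) * T + T) = ζ (j + 1))
    (hZ : ∀ j, IsArc o J k₁ k₂ ε ((k₀ + j : ℕ) * T) ((k₀ + j : ℕ) * T + T) (Z j)) :
    ∃ z : ℝ → State, (∀ j, z ((k₀ + j : ℕ) * T) = ζ j) ∧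
      ∀ k : ℕ, k₀ ≤ k → IsArc o J k₁ k₂ ε (k * T) ((k + 1) * T) z := by
  -- The arc is selected by the sampling interval containing `t`. A right endpoint thus takes its
  -- value from the next arc, and the two values agree by `h0` and `h1`.
  let z : ℝ → State := fun t => Z (⌊t / T⌋₊ - k₀) t
  have hstart : ∀ j, z ((k₀ + j : ℕ) * T) = ζ j := fun j => by
    have : ⌊((k₀ + j : ℕ) * T : ℝ) / T⌋₊ = k₀ + j := by
      rw [mul_div_cancel_right₀ _ hT.ne', Nat.floor_natCast]
    simp only [z, this, add_tsub_cancel_left, h0]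
  refine ⟨z, hstart, fun k hk => ?_⟩
  obtain ⟨j, rfl⟩ := Nat.exists_eq_add_of_le hk
  rw [add_mul, one_mul]
  refine (hZ j).congr (by linarith) fun t ht => ?_
  rcases ht.2.eq_or_lt with h | h
  · have e : ((k₀ + j : ℕ) * T + T : ℝ) = (k₀ + (j + 1) : ℕ) * T := by push_cast; ring
    rw [h, h1, e, hstart]
  · have : ⌊t / T⌋₊ = k₀ + j := by
      have hl : ((k₀ + j : ℕ) : ℝ) ≤ t / T := (le_div_iff₀ hT).2 ht.1
      rw [Nat.floor_eq_iff ((Nat.cast_nonneg _).trans hl)]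
      refine ⟨hl, (div_lt_iff₀ hT).2 ?_⟩
      linarith
    simp only [z, this, add_tsub_cancel_left]

theorem exists_locallyExpStable (o : Orbit) (hR : o.R ≠ 0) (hn : 0 < o.n)
    {J : Matrix (Fin 3) (Fin 3) ℝ} (hJ : IsUnit J.det) {k₁ k₂ : ℝ} (hk₁ : 0 < k₁) (hk₂ : 0 < k₂)
    {T : ℝ} (hT : 0 < T) {P : Matrix (Fin 3 ⊕ Fin 3) (Fin 3 ⊕ Fin 3) ℝ}
    (hP : IsLyapunovSolution (averagedMatrix J k₁ k₂ (o.Lav T)) P) :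
    ∃ ε₁ > 0, ∀ ε, 0 < ε → ε ≤ ε₁ → LocallyExpStable o J k₁ k₂ ε T := by
  obtain ⟨ε₁, hε₁, h⟩ := exists_decay_of_isArc o hR hn J hk₁ hk₂ hT hP
  refine ⟨ε₁, hε₁, fun ε hε hεle => ?_⟩
  obtain ⟨hε1, hgr, hex, δ, hδ, K, hK, κ, hκ0, hκ1, hdec⟩ := h ε hε hεle
  have hinv : ∀ ω : Fin 3 → ℝ, ε • ε⁻¹ • ω = ω := fun ω => by
    rw [smul_smul, mul_inv_cancel₀ hε.ne', one_smul]
  have hsmall : ∀ (q₀ : Fin 4 → ℝ) (ω₀ : Fin 3 → ℝ), stateErr q₀ ω₀ < ε * δ →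
      ‖((q₀, ε⁻¹ • ω₀) : State) - zbar‖ ≤ δ := fun q₀ ω₀ h0 => by
    refine (norm_sub_zbar_le_stateErr q₀ ω₀ hε hε1).trans ?_
    rw [inv_mul_le_iff₀ hε]
    exact h0.le
  -- The constant collects 3 from the norms, 2 from growth within an interval, `κ⁻¹` from rounding
  -- `t` down to a sampling instant, and `ε⁻¹` from the scaling of `ω`.
  refine ⟨ε * δ, by positivity, 6 * K * κ⁻¹ * ε⁻¹, by positivity, -Real.log κ / T,
    div_pos (neg_pos.2 (Real.log_neg hκ0 hκ1)) hT, fun k₀ => ⟨fun q₀ ω₀ hq₀ h0 => ?_,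
    fun q ω hsol h0 t ht => ?_⟩⟩
  -- The arcs are chosen for every initial value, with a dummy outside the ball, so that the samples
  -- `ζ` can be defined by recursion before they are known to stay near the equilibrium.
  · have hex' : ∀ (j : ℕ) (z₀ : State), ∃ z : ℝ → State, ‖z₀ - zbar‖ ≤ 1 / 2 →
        z ((k₀ + j : ℕ) * T) = z₀ ∧
          IsArc o J k₁ k₂ ε ((k₀ + j : ℕ) * T) ((k₀ + j : ℕ) * T + T) z := by
      intro j z₀
      by_cases hz₀ : ‖z₀ - zbar‖ ≤ 1 / 2
      · obtain ⟨z, hz⟩ := hex ((k₀ + j : ℕ) * T) z₀ hz₀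
        exact ⟨z, fun _ => hz⟩
      · exact ⟨fun _ => 0, fun hz => absurd hz hz₀⟩
    choose Φ hΦ using hex'
    let ζ : ℕ → State := fun j => Nat.rec (q₀, ε⁻¹ • ω₀)
      (fun j z₀ => Φ j z₀ ((k₀ + j : ℕ) * T + T)) j
    have hζ := hdec k₀ ζ ((norm_toLp_eq_one_iff q₀).1 hq₀) (hsmall q₀ ω₀ h0)
      fun j hj => ⟨Φ j (ζ j), (hΦ j (ζ j) hj).1, rfl, (hΦ j (ζ j) hj).2⟩
    obtain ⟨z, hz, harc⟩ := exists_concat_isArc hT k₀ (Z := fun j => Φ j (ζ j))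
      (fun j => (hΦ j (ζ j) (hζ j).2.1).1) (fun _ => rfl) (fun j => (hΦ j (ζ j) (hζ j).2.1).2)
    have hz0 : z (k₀ * T) = (q₀, ε⁻¹ • ω₀) := hz 0
    refine ⟨_, _, isSolution_of_isArc hJ hT harc fun k hk => ?_, by rw [hz0], by rw [hz0, hinv]⟩
    obtain ⟨j, rfl⟩ := Nat.exists_eq_add_of_le hk
    rw [hz]
    exact (hζ j).1
  · set z : ℝ → State := fun t => (q t, ε⁻¹ • ω t)
    have harc : ∀ j : ℕ, IsArc o J k₁ k₂ ε ((k₀ + j : ℕ) * T) ((k₀ + j : ℕ) * T + T) z := fun j => by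
      have := hsol.isArc hJ hε.ne' (Nat.le_add_right k₀ j)
      rwa [add_mul, one_mul] at this
    have hζ := hdec k₀ (fun j => z ((k₀ + j : ℕ) * T))
      ((norm_toLp_eq_one_iff _).1 (hsol.unit _ le_rfl)) (hsmall _ _ h0)
      fun j _ => ⟨z, rfl, by congr 1; push_cast; ring, harc j⟩
    have ht0 : 0 ≤ t / T := div_nonneg (le_trans (by positivity) ht) hT.le
    obtain ⟨j, hj⟩ := Nat.exists_eq_add_of_le (Nat.le_floor ((le_div_iff₀ hT).2 ht))
    have hjl : ((k₀ + j : ℕ) : ℝ) * T ≤ t := by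
      rw [← hj]; exact (le_div_iff₀ hT).1 (Nat.floor_le ht0)
    have hjr : t ≤ ((k₀ + j : ℕ) : ℝ) * T + T := by
      have := ((div_lt_iff₀ hT).1 (Nat.lt_floor_add_one (t / T))).le
      rw [hj] at this
      linarith
    have hb := hgr _ z (harc j) (hζ j).2.1 t ⟨hjl, hjr⟩
    have hd := (hζ j).2.2
    have h0' : ‖z ((k₀ + 0 : ℕ) * T) - zbar‖ ≤ ε⁻¹ * stateErr (q (k₀ * T)) (ω (k₀ * T)) :=
      norm_sub_zbar_le_stateErr _ _ hε hε1
    have hexp : κ ^ j ≤ κ⁻¹ * Real.exp (-(-Real.log κ / T) * (t - k₀ * T)) := by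
      rw [← div_eq_inv_mul, le_div_iff₀ hκ0, ← pow_succ, ← Real.exp_log (pow_pos hκ0 (j + 1)),
        Real.log_pow, Real.exp_le_exp]
      have h1 : (t - k₀ * T) / T ≤ ((j + 1 : ℕ) : ℝ) := by
        rw [div_le_iff₀ hT]
        push_cast at hjr ⊢
        linarith
      have h2 := mul_le_mul_of_nonpos_right h1 (Real.log_neg hκ0 hκ1).le
      calc _ ≤ _ := h2
        _ = _ := by ring
    calc stateErr (q t) (ω t) ≤ 3 * ‖z t - zbar‖ := stateErr_le_norm_sub_zbar _ _ hε hε1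
      _ ≤ 3 * (2 * (K * (κ⁻¹ * Real.exp (-(-Real.log κ / T) * (t - k₀ * T)))
          * (ε⁻¹ * stateErr (q (k₀ * T)) (ω (k₀ * T))))) := by
          refine mul_le_mul_of_nonneg_left (hb.trans (mul_le_mul_of_nonneg_left (hd.trans ?_)
            zero_le_two)) (by norm_num)
          gcongr
      _ = _ := by ring

/-- If `Aᵀ P A` were zero, division by zero would give `ε₀ = 0`. It is nonzero because the block
`I/2` keeps `A` from annihilating a pure velocity vector and `P` is positive definite. -/
theorem eps₀_pos {T : ℝ} (hT : 0 < T) (J M : Matrix (Fin 3) (Fin 3) ℝ) (k₁ k₂ : ℝ)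
    {P : Matrix (Fin 3 ⊕ Fin 3) (Fin 3 ⊕ Fin 3) ℝ} (hP : P.PosDef) :
    0 < eps₀ T (averagedMatrix J k₁ k₂ M) P := by
  set A := averagedMatrix J k₁ k₂ M
  have hne : Aᵀ * P * A ≠ 0 := by
    intro h
    set x : Fin 3 ⊕ Fin 3 → ℝ := Pi.single (Sum.inr 0) 1
    have hAx : A *ᵥ x ≠ 0 := fun h0 => by
      have := congrFun h0 (Sum.inl 0)
      simp [A, x, averagedMatrix] at this
    have h1 := ((posDef_iff_quadForm P).1 hP).2 _ hAx
    have h2 : x ⬝ᵥ (Aᵀ * P * A) *ᵥ x = (A *ᵥ x) ⬝ᵥ P *ᵥ (A *ᵥ x) := by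
      rw [← Matrix.mulVec_mulVec, ← Matrix.mulVec_mulVec, dotProduct_transpose_mulVec,
        dotProduct_comm]
    rw [h, Matrix.zero_mulVec, dotProduct_zero] at h2
    exact h1.ne h2
  have : 0 < ‖Matrix.toEuclideanCLM (𝕜 := ℝ) (n := Fin 3 ⊕ Fin 3) (Aᵀ * P * A)‖ :=
    norm_pos_iff.2 fun h => hne ((map_eq_zero_iff _ (EquivLike.injective _)).1 h)
  rw [eps₀]
  positivity

end MagSat

end

/-! ### Assembly of the proposition. -/

theorem proposition3 (o : MagSat.Orbit) (hμ : 0 < o.μ) (hR : 0 < o.R) (hn : 0 < o.n)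
    (J : Matrix (Fin 3) (Fin 3) ℝ) (hJ : J.PosDef)
    (k₁ k₂ : ℝ) (hk₁ : 0 < k₁) (hk₂ : 0 < k₂) :
    (∀ T > 0, ∀ s : ℤ, Tendsto (o.meanL T s) atTop (𝓝 (o.Lav T))) ∧
    Tendsto o.Lav (𝓝[>] (0 : ℝ)) (𝓝 o.Lav₀) ∧
    (o.Lav₀.PosDef →
      ∃ Tstar > 0, ∀ T : ℝ, 0 < T → T < Tstar →
        (∃ P, MagSat.IsLyapunovSolution (o.As J k₁ k₂ T) P) ∧
        ∀ P, MagSat.IsLyapunovSolution (o.As J k₁ k₂ T) P →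
          ∃ ε₁ > 0, ε₁ ≤ MagSat.eps₀ T (o.As J k₁ k₂ T) P ∧
            ∀ ε : ℝ, 0 < ε → ε ≤ ε₁ → MagSat.LocallyExpStable o J k₁ k₂ ε T) := by
  refine ⟨fun T hT s => o.tendsto_meanL hR.ne' hn hT s, o.tendsto_Lav hR.ne' hn, fun hpos => ?_⟩
  -- `As` unfolds to `averagedMatrix` at `Lav T`, so solvability of the Lyapunov equation for small
  -- `T` follows from convergence to `Lav₀`.
  obtain ⟨Tstar, hTstar, h⟩ := mem_nhdsGT_iff_exists_Ioo_subset.1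
    (MagSat.eventually_exists_lyapunov (o.tendsto_Lav hR.ne' hn) hJ hpos hk₁ hk₂)
  refine ⟨Tstar, hTstar, fun T hT hTlt => ⟨h ⟨hT, hTlt⟩, fun P hP => ?_⟩⟩
  obtain ⟨ε₁, hε₁, hstab⟩ :=
    MagSat.exists_locallyExpStable o hR.ne' hn hJ.det_pos.ne'.isUnit hk₁ hk₂ hT hP
  have h0 : 0 < MagSat.eps₀ T (o.As J k₁ k₂ T) P := MagSat.eps₀_pos hT J (o.Lav T) k₁ k₂ hP.1
  exact ⟨min ε₁ (MagSat.eps₀ T (o.As J k₁ k₂ T) P), lt_min hε₁ h0, min_le_right _ _,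
    fun ε hε hεle => hstab ε hε (hεle.trans (min_le_left _ _))⟩
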